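/- Let $\mathcal D=\mathcal S(\mathbb R)\subset L^2(\mathbb R)$ be the Schwartz space, let $P=-i\,\frac{d}{dx}$, and let $H_0=P^2$ be the free Hamiltonian on $\mathcal D$; $e^{-isH_0}$ is the unitary operator on $L^2(\mathbb R)$ that is multiplication by $e^{-isp^2}$ in momentum space. Let $V:\mathbb R\to\mathbb R$ be a real potential that is defined on $\mathcal D$, i.e. $V\Phi\in L^2(\mathbb R)$ for all $\Phi\in\mathcal D$, and suppose that for every $t\ge 0$ there is a compact operator $C_t$ on $L^2(\mathbb R)$ such that $$\int_0^t \|V e^{-isH_0}\Phi\|^2\,ds\le\|C_t\Phi\|^2\qquad\text{for all }\Phi\in\mathcal D .$$ Then $H=H_0+V$ is essentially self-adjoint on $\mathcal D$, and, with $e^{itH}$ denoting the unique strongly continuous one-parameter unitary group generated by the closure of $H$ (that is, $\frac{d}{dt}e^{itH}\psi\,|_{t=0}=i\overline H\psi$ exactly for $\psi$ in the domain of $\overline H$), the operator $e^{itH}e^{-itH_0}-1$ is compact for every $t\in\mathbb R$. -/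

import Mathlib

open MeasureTheory SchwartzMap FourierTransform
open scoped ENNReal

noncomputable section

namespace SchrodingerPerturbation

/-- The Hilbert space `L²(ℝ)` of complex-valued functions. -/
abbrev L2 : Type := Lp (α := ℝ) ℂ 2 volume

/-- The linear operator in `L²(ℝ)` with domain the Schwartz space `𝒟` (regarded as a subspace of
`L²(ℝ)`) that sends the class of a Schwartz function `Φ` to `T Φ`. -/
def onSchwartz (T : 𝓢(ℝ, ℂ) →ₗ[ℂ] L2) : L2 →ₗ.[ℂ] L2 where
  domain := LinearMap.range (toLpCLM ℂ (E := ℝ) ℂ 2 volume).toLinearMap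
  toFun := T ∘ₗ (LinearEquiv.ofInjective (toLpCLM ℂ (E := ℝ) ℂ 2 volume).toLinearMap
    (injective_toLp 2 volume)).symm.toLinearMap

/-- The momentum operator `P = -i d/dx` on Schwartz functions. -/
def momentum : 𝓢(ℝ, ℂ) →ₗ[ℂ] 𝓢(ℝ, ℂ) :=
  (-Complex.I) • (derivCLM ℂ ℂ).toLinearMap

/-- The free Hamiltonian `H₀ = P²` as an operator in `L²(ℝ)` with domain `𝒟`. -/
def freeHamiltonian : L2 →ₗ.[ℂ] L2 :=
  onSchwartz ((toLpCLM ℂ (E := ℝ) ℂ 2 volume).toLinearMap ∘ₗ momentum ∘ₗ momentum)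

/-- The potential `V = V(Q)` is defined on `𝒟`: the product `V Φ` is in `L²(ℝ)` for every
Schwartz function `Φ`. -/
def DefinedOnSchwartz (V : ℝ → ℝ) : Prop :=
  ∀ Φ : 𝓢(ℝ, ℂ), MemLp (fun x => (V x : ℂ) * Φ x) 2 volume

/-- The operator of multiplication by `V` in `L²(ℝ)`, with domain `𝒟`. -/
def potential (V : ℝ → ℝ) (hV : DefinedOnSchwartz V) : L2 →ₗ.[ℂ] L2 :=
  onSchwartz
    { toFun := fun Φ => (hV Φ).toLp
      map_add' := fun Φ Ψ => by
        rw [← MemLp.toLp_add]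
        apply MemLp.toLp_congr
        filter_upwards with x
        simp [mul_add]
      map_smul' := fun c Φ => by
        rw [RingHom.id_apply, ← MemLp.toLp_const_smul]
        apply MemLp.toLp_congr
        filter_upwards with x
        simp [mul_left_comm] }

/-- The Hamiltonian `H = H₀ + V` with domain `𝒟`. -/
def hamiltonian (V : ℝ → ℝ) (hV : DefinedOnSchwartz V) : L2 →ₗ.[ℂ] L2 :=
  freeHamiltonian + potential V hV

/-- The function `ξ ↦ exp(i t (2πξ)²)`. With the normalization `𝓕 f (ξ) = ∫ e^{-2πixξ} f(x) dx`,
the momentum operator `P` is multiplication by `2πξ` in Fourier space. -/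
def freePhase (t : ℝ) (ξ : ℝ) : ℂ :=
  Complex.exp (Complex.I * ((t * (2 * Real.pi * ξ) ^ 2 : ℝ) : ℂ))

theorem memLp_freePhase (t : ℝ) : MemLp (freePhase t) ∞ (volume : Measure ℝ) := by
  refine memLp_top_of_bound (C := 1) ?_ ?_
  · have h : Continuous (freePhase t) := by
      unfold freePhase
      fun_prop
    exact h.aestronglyMeasurable
  · filter_upwards with ξ
    rw [freePhase, mul_comm, Complex.norm_exp_ofReal_mul_I]

/-- The unitary operator `e^{itH₀}` on `L²(ℝ)`, `H₀ = P²`, given by multiplication by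
`exp(i t p²)`, `p = 2πξ`, in Fourier space. -/
def freeGroup (t : ℝ) : L2 →L[ℂ] L2 :=
  (Lp.fourierTransformₗᵢ ℝ ℂ).symm.toContinuousLinearEquiv.toContinuousLinearMap ∘L
    ((ContinuousLinearMap.mul ℂ ℂ).holderL volume ∞ 2 2 (memLp_freePhase t).toLp) ∘L
      (Lp.fourierTransformₗᵢ ℝ ℂ).toContinuousLinearEquiv.toContinuousLinearMap

/-- A linear operator in a Hilbert space is essentially self-adjoint on its domain if it is
closable with self-adjoint closure. -/
def IsEssentiallySelfAdjoint {E : Type*} [NormedAddCommGroup E] [InnerProductSpace ℂ E]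
    [CompleteSpace E] (A : E →ₗ.[ℂ] E) : Prop :=
  A.IsClosable ∧ IsSelfAdjoint A.closure

/-- `U` is the strongly continuous one-parameter unitary group `t ↦ e^{itA}`: its generator is
`iA`, that is, `ψ` is in the domain of `A` with `A ψ = χ` if and only if `t ↦ U t ψ` has the
derivative `i χ` at `t = 0`. -/
structure IsExpGroup {E : Type*} [NormedAddCommGroup E] [InnerProductSpace ℂ E]
    [CompleteSpace E] (A : E →ₗ.[ℂ] E) (U : ℝ → E →L[ℂ] E) : Prop where
  map_zero : U 0 = 1
  map_add : ∀ s t : ℝ, U (s + t) = U s ∘L U t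
  mem_unitary : ∀ t : ℝ, U t ∈ unitary (E →L[ℂ] E)
  continuous : ∀ ψ : E, Continuous fun t : ℝ => U t ψ
  mem_graph_iff : ∀ ψ χ : E,
    (ψ, χ) ∈ A.graph ↔ HasDerivAt (fun t : ℝ => U t ψ) (Complex.I • χ) 0

end SchrodingerPerturbation

end


/-!
Let `H₀` generate the group `G` and let `V` satisfy `∫₀^τ ‖V G(-s) Φ‖² ds ≤ ‖C Φ‖²` on an invariant
core of `H₀`. The one-dimensional Sobolev inequality in the time variable,
`τ ‖f(0)‖ ≤ ∫₀^τ ‖f‖ + τ ∫₀^τ ‖f'‖`, applied to `f(s) = ⟨V Ψ, G(-s) Φ⟩`, turns this into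
`√τ ‖V Φ‖ ≤ ‖C Φ‖ + τ ‖C H₀ Φ‖`. Letting `τ` tend to `0`, `V` is infinitesimally `H₀`-bounded, and
`H₀ + V` is essentially self-adjoint by Kato–Rellich. Its closure generates a unitary group `U`,
obtained as the limit of the groups generated by the Yosida approximations.

By Duhamel's formula and Cauchy–Schwarz `‖(U(t) G(-t) - 1) Φ‖ ≤ √t ‖C Φ‖` for `t ∈ [0, τ]`, so that
`U(t) G(-t) - 1` is compact for small `t ≥ 0`. The times at which it is compact form a subgroup of
`ℝ`, so it is compact for all `t`.
-/

noncomputable section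

open Filter Topology

namespace SchrodingerPerturbation

section StrongConvergence

variable {𝕜 E F ι : Type*} [NontriviallyNormedField 𝕜] [NormedAddCommGroup E] [NormedSpace 𝕜 E]
  [NormedAddCommGroup F] [NormedSpace 𝕜 F] {l : Filter ι} {T : ι → E →L[𝕜] F} {c : ℝ}

theorem tendsto_zero_of_dense (hT : ∀ i x, ‖T i x‖ ≤ c * ‖x‖) {D : Set E} (hD : Dense D)
    (h : ∀ x ∈ D, Tendsto (fun i => T i x) l (𝓝 0)) (x : E) :
    Tendsto (fun i => T i x) l (𝓝 0) := by
  have hLip : ∀ i, LipschitzWith c.toNNReal (T i) := fun i =>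
    AddMonoidHomClass.lipschitz_of_bound (T i) c (hT i)
  exact ((LipschitzWith.uniformEquicontinuous _ _ hLip).equicontinuous x).tendsto_of_mem_closure
    tendsto_const_nhds h (hD x)

theorem tendsto_apply_of_norm_le (hT : ∀ i x, ‖T i x‖ ≤ c * ‖x‖) {g : ι → E} {x : E} {y : F}
    (hg : Tendsto g l (𝓝 x)) (h : Tendsto (fun i => T i x) l (𝓝 y)) :
    Tendsto (fun i => T i (g i)) l (𝓝 y) := by
  have h_diff : Tendsto (fun i => T i (g i - x)) l (𝓝 0) := by
    refine squeeze_zero_norm (fun i => hT i _) ?_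
    simpa using (tendsto_iff_norm_sub_tendsto_zero.1 hg).const_mul c
  simpa using h.add h_diff

end StrongConvergence

section UnitaryGroup

variable {E : Type*} [NormedAddCommGroup E] [InnerProductSpace ℂ E] [CompleteSpace E]

/-- A strongly continuous one-parameter unitary group. -/
structure IsUnitaryGroup (U : ℝ → E →L[ℂ] E) : Prop where
  map_zero : U 0 = 1
  map_add : ∀ s t : ℝ, U (s + t) = U s ∘L U t
  mem_unitary : ∀ t : ℝ, U t ∈ unitary (E →L[ℂ] E)
  continuous : ∀ ψ : E, Continuous fun t : ℝ => U t ψ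

theorem IsExpGroup.isUnitaryGroup {A : E →ₗ.[ℂ] E} {U : ℝ → E →L[ℂ] E} (h : IsExpGroup A U) :
    IsUnitaryGroup U :=
  ⟨h.map_zero, h.map_add, h.mem_unitary, h.continuous⟩

namespace IsUnitaryGroup

variable {U W : ℝ → E →L[ℂ] E}

theorem of_norm_map (h_zero : U 0 = 1) (h_add : ∀ s t, U (s + t) = U s ∘L U t)
    (h_norm : ∀ t x, ‖U t x‖ = ‖x‖) {D : Set E} (hD : Dense D)
    (h_cont : ∀ x ∈ D, ContinuousAt (fun t => U t x) 0) : IsUnitaryGroup U := by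
  have h_mul (t : ℝ) : U t * U (-t) = 1 := by
    rw [ContinuousLinearMap.mul_def, ← h_add, add_neg_cancel, h_zero]
  have h_star (t : ℝ) : star (U t) * U t = 1 :=
    (ContinuousLinearMap.norm_map_iff_adjoint_comp_self (U t)).1 (h_norm t)
  refine ⟨h_zero, h_add, fun t => ⟨h_star t, ?_⟩, fun x => ?_⟩
  · rw [left_inv_eq_right_inv (h_star t) (h_mul t), h_mul]
  have h_lim : Tendsto (fun t => (U t - 1) x) (𝓝 0) (𝓝 0) := by
    refine tendsto_zero_of_dense (c := 2) (fun t x => ?_) hD (fun x hx => ?_) x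
    · calc ‖U t x - x‖ ≤ ‖U t x‖ + ‖x‖ := norm_sub_le _ _
        _ = 2 * ‖x‖ := by rw [h_norm]; ring
    · simpa [ContinuousAt, h_zero] using (h_cont x hx).sub_const x
  refine continuous_iff_continuousAt.2 fun t => ?_
  have h_sub : Tendsto (fun s : ℝ => s - t) (𝓝 t) (𝓝 0) := by
    simpa using (continuous_sub_right t).tendsto t
  have h_split (s : ℝ) : U s x = U t ((U (s - t) - 1) x) + U t x := by
    rw [sub_apply, one_apply_eq_self, map_sub, sub_add_cancel,
      ← ContinuousLinearMap.comp_apply, ← h_add, add_sub_cancel]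
  have h_tend := (((U t).continuous.tendsto 0).comp (h_lim.comp h_sub)).add_const (U t x)
  rw [_root_.map_zero, zero_add] at h_tend
  exact h_tend.congr fun s => (h_split s).symm

theorem inner_map_map (hU : IsUnitaryGroup U) (t : ℝ) (x y : E) :
    inner ℂ (U t x) (U t y) = inner ℂ x y :=
  ContinuousLinearMap.inner_map_map_of_mem_unitary (hU.mem_unitary t) x y

theorem norm_map (hU : IsUnitaryGroup U) (t : ℝ) (x : E) : ‖U t x‖ = ‖x‖ :=
  ContinuousLinearMap.norm_map_of_mem_unitary (hU.mem_unitary t) x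

theorem map_zero_apply (hU : IsUnitaryGroup U) (x : E) : U 0 x = x := by
  rw [hU.map_zero, one_apply_eq_self]

theorem map_add_apply (hU : IsUnitaryGroup U) (s t : ℝ) (x : E) : U (s + t) x = U s (U t x) := by
  rw [hU.map_add, ContinuousLinearMap.comp_apply]

theorem map_neg_map (hU : IsUnitaryGroup U) (t : ℝ) (x : E) : U (-t) (U t x) = x := by
  rw [← hU.map_add_apply, neg_add_cancel, hU.map_zero_apply]

theorem map_comm (hU : IsUnitaryGroup U) (s t : ℝ) (x : E) : U s (U t x) = U t (U s x) := by
  rw [← hU.map_add_apply, ← hU.map_add_apply, add_comm]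

theorem tendsto_apply (hU : IsUnitaryGroup U) {α : Type*} {l : Filter α} {f : α → ℝ} {g : α → E}
    {t : ℝ} {x : E} (hf : Tendsto f l (𝓝 t)) (hg : Tendsto g l (𝓝 x)) :
    Tendsto (fun a => U (f a) (g a)) l (𝓝 (U t x)) :=
  tendsto_apply_of_norm_le (c := 1) (fun a x => by rw [hU.norm_map, one_mul]) hg
    (((hU.continuous x).tendsto t).comp hf)

theorem continuous_apply (hU : IsUnitaryGroup U) {α : Type*} [TopologicalSpace α] {f : α → ℝ}
    {g : α → E} (hf : Continuous f) (hg : Continuous g) : Continuous fun a => U (f a) (g a) :=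
  continuous_iff_continuousAt.2 fun a => hU.tendsto_apply (hf.tendsto a) (hg.tendsto a)

theorem hasDerivAt_map (hU : IsUnitaryGroup U) {x y : E} (h : HasDerivAt (fun t => U t x) y 0)
    (s : ℝ) : HasDerivAt (fun t => U t (U s x)) (U s y) 0 := by
  simp only [hU.map_comm _ s]
  exact ((U s).restrictScalars ℝ).hasFDerivAt.comp_hasDerivAt (0 : ℝ) h

theorem hasDerivAt (hU : IsUnitaryGroup U) {x y : E} (h : HasDerivAt (fun t => U t x) y 0)
    (t : ℝ) : HasDerivAt (fun t => U t x) (U t y) t := by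
  have h_shift := (hU.hasDerivAt_map h t)
  rw [← sub_self t] at h_shift
  simpa only [← hU.map_add_apply, sub_add_cancel] using h_shift.comp_sub_const t t

theorem hasDerivAt_neg (hU : IsUnitaryGroup U) {x y : E} (h : HasDerivAt (fun t => U t x) y 0)
    (t : ℝ) : HasDerivAt (fun t => U (-t) x) (-U (-t) y) t := by
  simpa only [neg_one_smul, Function.comp_def] using
    (hU.hasDerivAt h (-t)).scomp t (_root_.hasDerivAt_neg t)

theorem hasDerivAt_apply (hU : IsUnitaryGroup U) {φ : ℝ → E} {φ' η : E} {t : ℝ}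
    (hφ : HasDerivAt φ φ' t) (h : HasDerivAt (fun s => U s (φ t)) η t) :
    HasDerivAt (fun s => U s (φ s)) (U t φ' + η) t := by
  rw [hasDerivAt_iff_tendsto_slope] at *
  refine ((hU.tendsto_apply (tendsto_id.mono_left nhdsWithin_le_nhds) hφ).add h).congr fun s => ?_
  simp only [slope_def_module, id_eq]
  rw [ContinuousLinearMap.map_smul_of_tower, map_sub, ← smul_add, sub_add_sub_cancel]

theorem hasDerivAt_comp_neg (hU : IsUnitaryGroup U) (hW : IsUnitaryGroup W) {x y z : E} {s : ℝ}
    (hx : HasDerivAt (fun t => W t x) y 0) (hz : HasDerivAt (fun t => U t (W (-s) x)) z 0) :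
    HasDerivAt (fun t => U t (W (-t) x)) (U s (z - W (-s) y)) s := by
  convert hU.hasDerivAt_apply (hW.hasDerivAt_neg hx s) (hU.hasDerivAt hz s) using 1
  rw [map_sub, map_neg, neg_add_eq_sub]

theorem inner_hasDerivAt_symm (hU : IsUnitaryGroup U) {a b x y : E}
    (ha : HasDerivAt (fun t => U t a) (Complex.I • b) 0)
    (hx : HasDerivAt (fun t => U t x) (Complex.I • y) 0) : inner ℂ b x = inner ℂ a y := by
  have h_deriv : HasDerivAt (fun t => inner ℂ (U t a) (U t x))
      (inner ℂ (U 0 a) (Complex.I • y) + inner ℂ (Complex.I • b) (U 0 x)) 0 := ha.inner ℂ hx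
  simp only [hU.inner_map_map, hU.map_zero_apply, inner_smul_left, inner_smul_right,
    Complex.conj_I] at h_deriv
  have h_zero := h_deriv.unique (hasDerivAt_const 0 (inner ℂ a x))
  refine (mul_left_cancel₀ Complex.I_ne_zero ?_).symm
  linear_combination h_zero

end IsUnitaryGroup

end UnitaryGroup

section SelfAdjointness

variable {E : Type*} [NormedAddCommGroup E] [InnerProductSpace ℂ E] {A : E →ₗ.[ℂ] E} {r : ℝ}

/-- The operator `A + ir` on the domain of `A`. -/
def shift (A : E →ₗ.[ℂ] E) (r : ℝ) : A.domain →ₗ[ℂ] E :=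
  A.toFun + (r * Complex.I : ℂ) • A.domain.subtype

theorem shift_apply (A : E →ₗ.[ℂ] E) (r : ℝ) (x : A.domain) :
    shift A r x = A x + (r * Complex.I : ℂ) • (x : E) :=
  rfl

theorem norm_shift_sq (hA : A.IsFormalAdjoint A) (r : ℝ) (x : A.domain) :
    ‖shift A r x‖ ^ 2 = ‖A x‖ ^ 2 + r ^ 2 * ‖(x : E)‖ ^ 2 := by
  have h_real : (inner ℂ (A x) (x : E)).im = 0 := by
    rw [← Complex.conj_eq_iff_im, inner_conj_symm]
    exact (hA x x).symm
  rw [shift_apply, @norm_add_sq ℂ, inner_smul_right, norm_smul]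
  simp [h_real, mul_pow]

theorem norm_le_norm_shift (hA : A.IsFormalAdjoint A) (r : ℝ) (x : A.domain) :
    ‖A x‖ ≤ ‖shift A r x‖ := by
  refine le_of_sq_le_sq ?_ (norm_nonneg _)
  rw [norm_shift_sq hA]
  exact le_add_of_nonneg_right (by positivity)

theorem abs_mul_norm_le_norm_shift (hA : A.IsFormalAdjoint A) (r : ℝ) (x : A.domain) :
    |r| * ‖(x : E)‖ ≤ ‖shift A r x‖ := by
  refine le_of_sq_le_sq ?_ (norm_nonneg _)
  rw [norm_shift_sq hA, mul_pow, sq_abs]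
  exact le_add_of_nonneg_left (by positivity)

theorem injective_shift (hA : A.IsFormalAdjoint A) (hr : r ≠ 0) :
    Function.Injective (shift A r) := by
  refine (injective_iff_map_eq_zero _).2 fun x hx => ?_
  have h := abs_mul_norm_le_norm_shift hA r x
  rw [hx, norm_zero] at h
  simpa using nonpos_of_mul_nonpos_right h (abs_pos.2 hr)

theorem inner_shift_neg (hA : A.IsFormalAdjoint A) (r : ℝ) (x y : A.domain) :
    inner ℂ (shift A (-r) x) (y : E) = inner ℂ (x : E) (shift A r y) := by
  simp only [shift_apply, inner_add_left, inner_add_right, inner_smul_left, inner_smul_right,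
    hA x y]
  simp

theorem range_shift_eq_image_graph (A : E →ₗ.[ℂ] E) (r : ℝ) :
    Set.range (shift A r) =
      (fun p : E × E => p.2 + (r * Complex.I : ℂ) • p.1) '' (A.graph : Set (E × E)) := by
  ext z
  constructor
  · rintro ⟨x, rfl⟩
    exact ⟨(x, A x), A.mem_graph x, rfl⟩
  · rintro ⟨p, hp, rfl⟩
    obtain ⟨x, hx⟩ := A.mem_graph_iff'.1 hp
    exact ⟨x, by rw [← hx, shift_apply]⟩

theorem denseRange_shift_closure_iff (hA : A.IsClosable) :
    DenseRange (shift A.closure r) ↔ DenseRange (shift A r) := by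
  have h_cont : Continuous fun p : E × E => p.2 + (r * Complex.I : ℂ) • p.1 := by fun_prop
  rw [DenseRange, DenseRange, range_shift_eq_image_graph, range_shift_eq_image_graph,
    ← hA.graph_closure_eq_closure_graph, Submodule.topologicalClosure_coe]
  refine ⟨fun h => ?_, fun h => h.mono (Set.image_mono subset_closure)⟩
  exact dense_closure.1 (h.mono (image_closure_subset_closure_image h_cont))

theorem dense_domain_closure_iff (hA : A.IsClosable) :
    Dense (A.closure.domain : Set E) ↔ Dense (A.domain : Set E) := by
  have h_domain (B : E →ₗ.[ℂ] E) : (B.domain : Set E) = Prod.fst '' (B.graph : Set (E × E)) := by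
    rw [← B.graph_map_fst_eq_domain]
    rfl
  rw [h_domain, h_domain, ← hA.graph_closure_eq_closure_graph, Submodule.topologicalClosure_coe]
  refine ⟨fun h => ?_, fun h => h.mono (Set.image_mono subset_closure)⟩
  exact dense_closure.1 (h.mono (image_closure_subset_closure_image continuous_fst))

theorem isFormalAdjoint_closure (hc : A.IsClosable) (hA : A.IsFormalAdjoint A) :
    A.closure.IsFormalAdjoint A.closure := by
  have h_closed : IsClosed {p : (E × E) × (E × E) | inner ℂ p.1.2 p.2.1 = inner ℂ p.1.1 p.2.2} :=
    isClosed_eq (by fun_prop) (by fun_prop)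
  have h_graph (x : A.closure.domain) :
      ((x : E), A.closure x) ∈ closure (A.graph : Set (E × E)) := by
    rw [← Submodule.topologicalClosure_coe, hc.graph_closure_eq_closure_graph]
    exact A.closure.mem_graph x
  intro x y
  refine closure_minimal ?_ h_closed (closure_prod_eq.ge ⟨h_graph x, h_graph y⟩ :
    (((x : E), A.closure x), ((y : E), A.closure y)) ∈
      closure ((A.graph : Set (E × E)) ×ˢ (A.graph : Set (E × E))))
  rintro ⟨p, q⟩ ⟨hp, hq⟩
  obtain ⟨a, rfl⟩ := A.mem_graph_iff'.1 hp
  obtain ⟨b, rfl⟩ := A.mem_graph_iff'.1 hq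
  exact hA a b

theorem norm_le_of_dense_inner_le {D : Set E} (hD : Dense D) {x : E} {M : ℝ} (hM : 0 ≤ M)
    (h : ∀ y ∈ D, ‖inner ℂ y x‖ ≤ M * ‖y‖) : ‖x‖ ≤ M := by
  have h_closed : IsClosed {y : E | ‖inner ℂ y x‖ ≤ M * ‖y‖} :=
    isClosed_le (by fun_prop) (by fun_prop)
  rw [← innerSL_apply_norm ℂ x]
  refine ContinuousLinearMap.opNorm_le_bound _ hM fun y => ?_
  rw [innerSL_apply_apply, norm_inner_symm]
  exact closure_minimal h h_closed (hD y)

variable [CompleteSpace E]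

theorem isClosed_range_shift (hA : A.IsFormalAdjoint A) (hc : A.IsClosed) (hr : r ≠ 0) :
    IsClosed (Set.range (shift A r)) := by
  let f : A.graph →L[ℂ] E :=
    (ContinuousLinearMap.snd ℂ E E + (r * Complex.I : ℂ) • ContinuousLinearMap.fst ℂ E E) ∘L
      A.graph.subtypeL
  have h_range : Set.range (shift A r) = Set.range f := by
    rw [range_shift_eq_image_graph, Set.image_eq_range]
    rfl
  have h_bound (p : A.graph) : ‖p‖ ≤ (max |r|⁻¹ 1).toNNReal * ‖f p‖ := by
    obtain ⟨⟨x, y⟩, hp⟩ := p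
    obtain ⟨a, ha⟩ := A.mem_graph_iff'.1 hp
    obtain ⟨rfl, rfl⟩ := Prod.ext_iff.1 ha
    have hx : ‖(a : E)‖ ≤ |r|⁻¹ * ‖shift A r a‖ := by
      rw [le_inv_mul_iff₀ (abs_pos.2 hr)]
      exact abs_mul_norm_le_norm_shift hA r a
    rw [Real.coe_toNNReal _ (by positivity)]
    refine max_le (hx.trans ?_) ((norm_le_norm_shift hA r a).trans (le_mul_of_one_le_left ?_ ?_))
    · exact mul_le_mul_of_nonneg_right (le_max_left _ _) (norm_nonneg _)
    · exact norm_nonneg _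
    · exact le_max_right _ _
  have : CompleteSpace A.graph := (show IsClosed (A.graph : Set (E × E)) from hc).completeSpace_coe
  rw [h_range]
  exact (f.antilipschitz_of_bound h_bound).isClosed_range f.uniformContinuous

theorem surjective_shift_of_denseRange (hA : A.IsFormalAdjoint A) (hc : A.IsClosed) (hr : r ≠ 0)
    (h : DenseRange (shift A r)) : Function.Surjective (shift A r) := by
  rw [← Set.range_eq_univ, ← (isClosed_range_shift hA hc hr).closure_eq, h.closure_range]

theorem denseRange_of_inner_eq_zero {S : Type*} [AddCommGroup S] [Module ℂ S] {T : S →ₗ[ℂ] E}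
    (h : ∀ z, (∀ x, inner ℂ (T x) z = 0) → z = 0) : DenseRange T := by
  rw [DenseRange, ← LinearMap.coe_range, Submodule.dense_iff_topologicalClosure_eq_top,
    Submodule.topologicalClosure_eq_top_iff, Submodule.eq_bot_iff]
  exact fun z hz => h z fun x => hz _ ⟨x, rfl⟩

theorem isFormalAdjoint_of_isSelfAdjoint (hA : IsSelfAdjoint A) : A.IsFormalAdjoint A := by
  have h := LinearPMap.adjoint_isFormalAdjoint hA.dense_domain
  rwa [LinearPMap.isSelfAdjoint_def.1 hA] at h

theorem mem_graph_of_isSelfAdjoint (hA : IsSelfAdjoint A) {x y : E}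
    (h : ∀ a : A.domain, inner ℂ (A a) x = inner ℂ (a : E) y) : (x, y) ∈ A.graph := by
  rw [← LinearPMap.isSelfAdjoint_def.1 hA,
    LinearPMap.adjoint_graph_eq_graph_adjoint hA.dense_domain, Submodule.mem_adjoint_iff]
  intro a b hab
  obtain ⟨c, hc⟩ := A.mem_graph_iff'.1 hab
  obtain ⟨rfl, rfl⟩ := Prod.ext_iff.1 hc
  exact sub_eq_zero.2 (h c)

theorem surjective_shift_of_isSelfAdjoint (hA : IsSelfAdjoint A) (hr : r ≠ 0) :
    Function.Surjective (shift A r) := by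
  have hs := isFormalAdjoint_of_isSelfAdjoint hA
  refine surjective_shift_of_denseRange hs hA.isClosed hr ?_
  refine denseRange_of_inner_eq_zero fun z hz => ?_
  have h_graph : (z, (r * Complex.I : ℂ) • z) ∈ A.graph := by
    refine mem_graph_of_isSelfAdjoint hA fun a => ?_
    have h := hz a
    rw [shift_apply, inner_add_left, inner_smul_left] at h
    rw [inner_smul_right, eq_neg_of_add_eq_zero_left h]
    simp
  obtain ⟨x, hx⟩ := A.mem_graph_iff'.1 h_graph
  obtain ⟨rfl, h_apply⟩ := Prod.ext_iff.1 hx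
  have h_eigen : shift A (-r) x = 0 := by
    rw [shift_apply, show A x = (r * Complex.I : ℂ) • (x : E) from h_apply]
    simp
  have h_zero := injective_shift hs (neg_ne_zero.2 hr) (h_eigen.trans (map_zero _).symm)
  exact congrArg Subtype.val h_zero

theorem isSelfAdjoint_of_surjective_shift (hd : Dense (A.domain : Set E))
    (hA : A.IsFormalAdjoint A) (h : Function.Surjective (shift A r))
    (h_neg : DenseRange (shift A (-r))) : IsSelfAdjoint A := by
  rw [LinearPMap.isSelfAdjoint_def]
  refine le_antisymm (LinearPMap.le_of_le_graph ?_) (hA.le_adjoint hd)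
  intro p hp
  obtain ⟨x, rfl⟩ := A.adjoint.mem_graph_iff'.1 hp
  obtain ⟨y, hy⟩ := h (A.adjoint x + (r * Complex.I : ℂ) • (x : E))
  have h_eq : (x : E) = y := by
    rw [← sub_eq_zero]
    refine h_neg.eq_zero_of_inner_right ℂ ?_
    intro w
    have h_adj : inner ℂ (A w) (x : E) = inner ℂ (w : E) (A.adjoint x) :=
      (LinearPMap.adjoint_isFormalAdjoint hd).symm w x
    rw [inner_sub_right, inner_shift_neg hA, hy, shift_apply, inner_add_left, h_adj,
      inner_add_right, inner_smul_left, inner_smul_right]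
    simp
  have h_apply : A.adjoint x = A y := by
    rw [shift_apply, h_eq] at hy
    exact (add_right_cancel hy).symm
  rw [h_eq, h_apply]
  exact A.mem_graph y

theorem isEssentiallySelfAdjoint_of_denseRange_shift (hd : Dense (A.domain : Set E))
    (hA : A.IsFormalAdjoint A) (hr : r ≠ 0) (h : DenseRange (shift A r))
    (h_neg : DenseRange (shift A (-r))) : IsEssentiallySelfAdjoint A := by
  have hc : A.IsClosable :=
    (LinearPMap.adjoint_isClosed hd).isClosable.leIsClosable (hA.le_adjoint hd)
  have hs := isFormalAdjoint_closure hc hA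
  refine ⟨hc, isSelfAdjoint_of_surjective_shift (r := r) ((dense_domain_closure_iff hc).2 hd) hs ?_
    ((denseRange_shift_closure_iff hc).2 h_neg)⟩
  exact surjective_shift_of_denseRange hs hc.closure_isClosed hr
    ((denseRange_shift_closure_iff hc).2 h)

namespace IsEssentiallySelfAdjoint

theorem isFormalAdjoint (hA : IsEssentiallySelfAdjoint A) : A.IsFormalAdjoint A := by
  intro x y
  have h_apply (x : A.domain) : A x = A.closure ⟨(x : E), A.le_closure.1 x.2⟩ := A.le_closure.2 rfl
  rw [h_apply, h_apply]
  exact isFormalAdjoint_of_isSelfAdjoint hA.2 ⟨x, _⟩ ⟨y, _⟩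

theorem dense_domain (hA : IsEssentiallySelfAdjoint A) : Dense (A.domain : Set E) :=
  (dense_domain_closure_iff hA.1).1 hA.2.dense_domain

theorem denseRange_shift (hA : IsEssentiallySelfAdjoint A) (hr : r ≠ 0) :
    DenseRange (shift A r) :=
  (denseRange_shift_closure_iff hA.1).1 (surjective_shift_of_isSelfAdjoint hA.2 hr).denseRange

end IsEssentiallySelfAdjoint

end SelfAdjointness

section KatoRellich

variable {E : Type*} [NormedAddCommGroup E] [InnerProductSpace ℂ E]

/-- The operator `A + v` with the domain of `A`, for `v` defined on the domain of `A`. -/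
def perturb (A : E →ₗ.[ℂ] E) (v : A.domain →ₗ[ℂ] E) : E →ₗ.[ℂ] E :=
  ⟨A.domain, A.toFun + v⟩

theorem shift_perturb (A : E →ₗ.[ℂ] E) (v : A.domain →ₗ[ℂ] E) (r : ℝ) :
    shift (perturb A v) r = shift A r + v :=
  LinearMap.ext fun x => add_right_comm (A x) (v x) _

theorem isFormalAdjoint_perturb {A : E →ₗ.[ℂ] E} (hA : A.IsFormalAdjoint A)
    {v : A.domain →ₗ[ℂ] E} (hv : ∀ x y : A.domain, inner ℂ (v x) (y : E) = inner ℂ (x : E) (v y)) :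
    (perturb A v).IsFormalAdjoint (perturb A v) := fun x y =>
  (inner_add_left _ _ _).trans
    ((congrArg₂ (· + ·) (hA x y) (hv x y)).trans (inner_add_right _ _ _).symm)

variable [CompleteSpace E]

theorem denseRange_add_of_norm_le {S : Type*} [AddCommGroup S] [Module ℂ S] {T B : S →ₗ[ℂ] E}
    (hT : DenseRange T) {c : ℝ} (hc₀ : 0 ≤ c) (hc : c < 1) (hB : ∀ x, ‖B x‖ ≤ c * ‖T x‖) :
    DenseRange (T + B) := by
  refine denseRange_of_inner_eq_zero fun z hz => ?_
  have h_self : ‖z‖ ≤ c * ‖z‖ := by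
    refine norm_le_of_dense_inner_le hT (by positivity) ?_
    rintro _ ⟨x, rfl⟩
    have h_orth : inner ℂ (T x) z = -inner ℂ (B x) z :=
      eq_neg_of_add_eq_zero_left (by rw [← inner_add_left]; exact hz x)
    rw [h_orth, norm_neg, mul_right_comm]
    exact (norm_inner_le_norm _ _).trans (mul_le_mul_of_nonneg_right (hB x) (norm_nonneg z))
  by_contra h
  nlinarith [norm_pos_iff.2 h]

theorem isEssentiallySelfAdjoint_perturb {A : E →ₗ.[ℂ] E} (hA : IsEssentiallySelfAdjoint A)
    {v : A.domain →ₗ[ℂ] E} (hv : ∀ x y : A.domain, inner ℂ (v x) (y : E) = inner ℂ (x : E) (v y))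
    {a b : NNReal} (ha : a < 1) (hb : ∀ x : A.domain, ‖v x‖ ≤ a * ‖A x‖ + b * ‖(x : E)‖) :
    IsEssentiallySelfAdjoint (perturb A v) := by
  have hs := hA.isFormalAdjoint
  have ha' : (0 : ℝ) < 1 - a := sub_pos.2 (NNReal.coe_lt_one.2 ha)
  obtain ⟨r, hr, h_lt⟩ : ∃ r : ℝ, 0 < r ∧ a + b / r < 1 := by
    refine ⟨(b + 1) / (1 - a), by positivity, ?_⟩
    rw [div_div_eq_mul_div, ← lt_sub_iff_add_lt', div_lt_iff₀ (by positivity)]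
    nlinarith
  have h_rel (s : ℝ) (hs_abs : |s| = r) (x : A.domain) :
      ‖v x‖ ≤ (a + b / r) * ‖shift A s x‖ := by
    have hx : ‖(x : E)‖ ≤ ‖shift A s x‖ / r := by
      rw [le_div_iff₀' hr, ← hs_abs]
      exact abs_mul_norm_le_norm_shift hs s x
    calc ‖v x‖ ≤ a * ‖A x‖ + b * ‖(x : E)‖ := hb x
      _ ≤ a * ‖shift A s x‖ + b * (‖shift A s x‖ / r) := by
        gcongr
        exact norm_le_norm_shift hs s x
      _ = (a + b / r) * ‖shift A s x‖ := by ring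
  have h_dense (s : ℝ) (hs_abs : |s| = r) :
      DenseRange (shift (perturb A v) s) := by
    have hs₀ : s ≠ 0 := abs_pos.1 (hs_abs ▸ hr)
    rw [shift_perturb]
    exact denseRange_add_of_norm_le (hA.denseRange_shift hs₀) (by positivity) h_lt (h_rel s hs_abs)
  exact isEssentiallySelfAdjoint_of_denseRange_shift hA.dense_domain
    (isFormalAdjoint_perturb hs hv) hr.ne'
    (h_dense r (abs_of_pos hr)) (h_dense (-r) (by rw [abs_neg, abs_of_pos hr]))

end KatoRellich

section BoundedGenerator

variable {E : Type*} [NormedAddCommGroup E] [InnerProductSpace ℂ E] [CompleteSpace E]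
  {B B' : E →L[ℂ] E}

/-- The group `exp(itB)` generated by a bounded operator `B`. -/
def boundedExp (B : E →L[ℂ] E) (t : ℝ) : E →L[ℂ] E :=
  NormedSpace.exp (t • (Complex.I • B))

theorem hasDerivAt_boundedExp_apply (B : E →L[ℂ] E) (x : E) (t : ℝ) :
    HasDerivAt (fun s => boundedExp B s x) (boundedExp B t (Complex.I • B x)) t :=
  (ContinuousLinearMap.apply ℝ E x ∘L
    ContinuousLinearMap.restrictScalarsL ℂ E E ℝ ℝ).hasFDerivAt.comp_hasDerivAt t
      (hasDerivAt_exp_smul_const (𝕂 := ℝ) (Complex.I • B) t)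

theorem isUnitaryGroup_boundedExp (hB : IsSelfAdjoint B) : IsUnitaryGroup (boundedExp B) := by
  let : NormedAlgebra ℚ (E →L[ℂ] E) := NormedAlgebra.restrictScalars ℚ ℂ _
  refine ⟨by simp [boundedExp], fun s t => ?_, fun t => ?_, fun x => ?_⟩
  · rw [boundedExp, add_smul, NormedSpace.exp_add_of_commute
      (((Commute.refl _).smul_left _).smul_right _)]
    rfl
  · refine NormedSpace.exp_mem_unitary_of_mem_skewAdjoint (skewAdjoint.smul_mem t ?_)
    rw [skewAdjoint.mem_iff, star_smul, hB.star_eq, Complex.star_def, Complex.conj_I, neg_smul]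
  · exact continuous_iff_continuousAt.2 fun t => (hasDerivAt_boundedExp_apply B x t).continuousAt

theorem boundedExp_apply_comm (h : Commute B B') (t : ℝ) (x : E) :
    B (boundedExp B' t x) = boundedExp B' t (B x) :=
  DFunLike.congr_fun (Commute.exp_right ((h.smul_right _).smul_right _)).eq x

theorem norm_boundedExp_sub_le (hB : IsSelfAdjoint B) (hB' : IsSelfAdjoint B')
    (h : Commute B B') (t : ℝ) (x : E) :
    ‖boundedExp B t x - boundedExp B' t x‖ ≤ ‖B x - B' x‖ * |t| := by
  have hU := isUnitaryGroup_boundedExp hB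
  have hU' := isUnitaryGroup_boundedExp hB'
  have h_deriv_zero (B : E →L[ℂ] E) (hU : IsUnitaryGroup (boundedExp B)) (y : E) :
      HasDerivAt (fun t => boundedExp B t y) (Complex.I • B y) 0 := by
    simpa only [hU.map_zero_apply] using hasDerivAt_boundedExp_apply B y 0
  have h_deriv (s : ℝ) := hU'.hasDerivAt_comp_neg hU (s := s) (h_deriv_zero B hU x)
    (h_deriv_zero B' hU' _)
  have h_norm (s : ℝ) : ‖boundedExp B' s (Complex.I • B' (boundedExp B (-s) x) -
      boundedExp B (-s) (Complex.I • B x))‖ ≤ ‖B x - B' x‖ := by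
    rw [boundedExp_apply_comm h.symm, ← map_smul, ← map_sub, hU'.norm_map, hU.norm_map, ← smul_sub,
      norm_smul, Complex.norm_I, one_mul, norm_sub_rev]
  have h_mvt := convex_univ.norm_image_sub_le_of_norm_hasDerivWithin_le
    (fun s _ => (h_deriv s).hasDerivWithinAt) (fun s _ => h_norm s)
    (Set.mem_univ 0) (Set.mem_univ (-t))
  simp only [neg_neg, neg_zero, hU.map_zero_apply, hU'.map_zero_apply, sub_zero, norm_neg,
    Real.norm_eq_abs] at h_mvt
  rwa [← hU'.norm_map (-t), map_sub, hU'.map_neg_map]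

end BoundedGenerator

section Yosida

variable {E ι : Type*} [NormedAddCommGroup E] [InnerProductSpace ℂ E] [CompleteSpace E]
  {A : E →ₗ.[ℂ] E} {r s : ℝ}

/-- The bijection `A + ir` from the domain of a self-adjoint operator `A` onto the whole space, for
real `r ≠ 0`. -/
def shiftEquiv (hA : IsSelfAdjoint A) (hr : r ≠ 0) : A.domain ≃ₗ[ℂ] E :=
  LinearEquiv.ofBijective (shift A r) ⟨injective_shift (isFormalAdjoint_of_isSelfAdjoint hA) hr,
    surjective_shift_of_isSelfAdjoint hA hr⟩

theorem norm_shiftEquiv_symm_le (hA : IsSelfAdjoint A) (hr : r ≠ 0) (z : E) :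
    ‖((shiftEquiv hA hr).symm z : E)‖ ≤ |r|⁻¹ * ‖z‖ := by
  rw [le_inv_mul_iff₀ (abs_pos.2 hr)]
  exact (abs_mul_norm_le_norm_shift (isFormalAdjoint_of_isSelfAdjoint hA) r _).trans_eq
    (congrArg norm ((shiftEquiv hA hr).apply_symm_apply z))

/-- The resolvent `(A + ir)⁻¹` of a self-adjoint operator `A`, for real `r ≠ 0`. -/
def resolvent (hA : IsSelfAdjoint A) (hr : r ≠ 0) : E →L[ℂ] E :=
  (A.domain.subtype ∘ₗ (shiftEquiv hA hr).symm.toLinearMap).mkContinuous |r|⁻¹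
    (norm_shiftEquiv_symm_le hA hr)

theorem resolvent_shift (hA : IsSelfAdjoint A) (hr : r ≠ 0) (x : A.domain) :
    resolvent hA hr (shift A r x) = x :=
  congrArg Subtype.val ((shiftEquiv hA hr).symm_apply_apply x)

theorem norm_resolvent_le (hA : IsSelfAdjoint A) (hr : r ≠ 0) (z : E) :
    ‖resolvent hA hr z‖ ≤ |r|⁻¹ * ‖z‖ :=
  norm_shiftEquiv_symm_le hA hr z

theorem resolvent_apply (hA : IsSelfAdjoint A) (hr : r ≠ 0) (x : A.domain) :
    resolvent hA hr (A x) = (x : E) - (r * Complex.I : ℂ) • resolvent hA hr x := by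
  rw [eq_sub_iff_add_eq, ← map_smul, ← map_add]
  exact resolvent_shift hA hr x

theorem commute_resolvent (hA : IsSelfAdjoint A) (hr : r ≠ 0) (hs : s ≠ 0) :
    Commute (resolvent hA hr) (resolvent hA hs) := by
  ext z
  obtain ⟨x, rfl⟩ := surjective_shift_of_isSelfAdjoint hA hr z
  obtain ⟨w, hw⟩ := surjective_shift_of_isSelfAdjoint hA hs x
  have h_right : resolvent hA hs (shift A r x) = shift A r w := by
    have h_split : shift A r x = shift A s x + ((r - s) * Complex.I : ℂ) • (x : E) := by
      rw [shift_apply, shift_apply]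
      module
    rw [h_split, map_add, map_smul, resolvent_shift, ← hw, resolvent_shift, shift_apply,
      shift_apply]
    module
  change resolvent hA hr (resolvent hA hs (shift A r x)) =
    resolvent hA hs (resolvent hA hr (shift A r x))
  rw [h_right, resolvent_shift, resolvent_shift, ← hw, resolvent_shift]

theorem star_resolvent (hA : IsSelfAdjoint A) (hr : r ≠ 0) :
    star (resolvent hA hr) = resolvent hA (neg_ne_zero.2 hr) := by
  rw [ContinuousLinearMap.star_eq_adjoint, eq_comm, ContinuousLinearMap.eq_adjoint_iff]
  intro z w
  obtain ⟨x, rfl⟩ := surjective_shift_of_isSelfAdjoint hA (neg_ne_zero.2 hr) z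
  obtain ⟨y, rfl⟩ := surjective_shift_of_isSelfAdjoint hA hr w
  rw [resolvent_shift, resolvent_shift, inner_shift_neg (isFormalAdjoint_of_isSelfAdjoint hA)]

theorem tendsto_smul_resolvent (hA : IsSelfAdjoint A) {l : Filter ι} {r : ι → ℝ}
    (hr : ∀ i, r i ≠ 0) (h_lim : Tendsto (fun i => |r i|) l atTop) (x : E) :
    Tendsto (fun i => (r i * Complex.I : ℂ) • resolvent hA (hr i) x) l (𝓝 x) := by
  have h_norm (i : ι) (x : E) : ‖(r i * Complex.I : ℂ) • resolvent hA (hr i) x‖ ≤ ‖x‖ := by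
    rw [norm_smul, norm_mul, Complex.norm_I, mul_one, Complex.norm_real, Real.norm_eq_abs,
      ← le_inv_mul_iff₀ (abs_pos.2 (hr i))]
    exact norm_resolvent_le hA (hr i) x
  have h_zero := tendsto_zero_of_dense (l := l) (c := 2)
    (T := fun i => (r i * Complex.I : ℂ) • resolvent hA (hr i) - 1) (fun i x => ?_)
    hA.dense_domain (fun x hx => ?_) x
  · simpa using h_zero.add_const x
  · calc ‖(r i * Complex.I : ℂ) • resolvent hA (hr i) x - x‖
      _ ≤ ‖(r i * Complex.I : ℂ) • resolvent hA (hr i) x‖ + ‖x‖ := norm_sub_le _ _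
      _ ≤ 2 * ‖x‖ := by linarith [h_norm i x]
  · have h_bound : Tendsto (fun i => |r i|⁻¹ * ‖A ⟨x, hx⟩‖) l (𝓝 0) := by
      simpa using h_lim.inv_tendsto_atTop.mul_const ‖A ⟨x, hx⟩‖
    refine squeeze_zero_norm (fun i => ?_) h_bound
    convert norm_resolvent_le hA (hr i) (A ⟨x, hx⟩) using 1
    rw [resolvent_apply, norm_sub_rev]
    rfl

/-- The Yosida approximation `r² A (A² + r²)⁻¹` of a self-adjoint operator `A`, written as
`(r² / 2) ((A + ir)⁻¹ + (A - ir)⁻¹)`. -/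
def yosida (hA : IsSelfAdjoint A) (hr : r ≠ 0) : E →L[ℂ] E :=
  (r ^ 2 / 2) • (resolvent hA hr + resolvent hA (neg_ne_zero.2 hr))

theorem isSelfAdjoint_yosida (hA : IsSelfAdjoint A) (hr : r ≠ 0) :
    IsSelfAdjoint (yosida hA hr) := by
  rw [isSelfAdjoint_iff, yosida, star_smul, star_add, star_resolvent, star_resolvent, star_trivial,
    add_comm]
  simp only [neg_neg]

theorem commute_yosida (hA : IsSelfAdjoint A) (hr : r ≠ 0) (hs : s ≠ 0) :
    Commute (yosida hA hr) (yosida hA hs) := by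
  refine Commute.smul_left (Commute.smul_right ?_ _) _
  exact ((commute_resolvent hA _ _).add_right (commute_resolvent hA _ _)).add_left
    ((commute_resolvent hA _ _).add_right (commute_resolvent hA _ _))

theorem yosida_apply (hA : IsSelfAdjoint A) (hr : r ≠ 0) (x : A.domain) :
    yosida hA hr x = (1 / 2 : ℂ) • ((r * Complex.I : ℂ) • resolvent hA hr (A x) +
      ((-r : ℝ) * Complex.I : ℂ) • resolvent hA (neg_ne_zero.2 hr) (A x)) := by
  rw [resolvent_apply, resolvent_apply, yosida, smul_apply, add_apply, ← Complex.coe_smul]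
  push_cast
  match_scalars <;> ring_nf <;> simp only [Complex.I_sq] <;> ring

theorem tendsto_yosida (hA : IsSelfAdjoint A) {l : Filter ι} {r : ι → ℝ} (hr : ∀ i, r i ≠ 0)
    (h_lim : Tendsto (fun i => |r i|) l atTop) (x : A.domain) :
    Tendsto (fun i => yosida hA (hr i) x) l (𝓝 (A x)) := by
  simp only [yosida_apply]
  convert ((tendsto_smul_resolvent hA hr h_lim (A x)).add
    (tendsto_smul_resolvent hA (fun i => neg_ne_zero.2 (hr i)) (by simpa only [abs_neg])
      (A x))).const_smul (1 / 2 : ℂ) using 2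
  module

end Yosida

section Stone

variable {E : Type*} [NormedAddCommGroup E] [InnerProductSpace ℂ E] [CompleteSpace E]
  {U : ℝ → E →L[ℂ] E} {W : ℕ → ℝ → E →L[ℂ] E}

theorem isUnitaryGroup_of_tendstoLocallyUniformly (hW : ∀ n, IsUnitaryGroup (W n))
    (h : ∀ x, TendstoLocallyUniformly (fun n t => W n t x) (fun t => U t x) atTop) :
    IsUnitaryGroup U := by
  have h_lim (t : ℝ) (x : E) : Tendsto (fun n => W n t x) atTop (𝓝 (U t x)) :=
    (tendstoLocallyUniformlyOn_univ.2 (h x)).tendsto_at (Set.mem_univ t)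
  refine IsUnitaryGroup.of_norm_map (ContinuousLinearMap.ext fun x => ?_)
    (fun s t => ContinuousLinearMap.ext fun x => ?_) (fun t x => ?_) dense_univ fun x _ => ?_
  · refine tendsto_nhds_unique (h_lim 0 x) ?_
    simp only [(hW _).map_zero, tendsto_const_nhds]
  · refine tendsto_nhds_unique (h_lim (s + t) x) ?_
    simp only [(hW _).map_add_apply]
    exact tendsto_apply_of_norm_le (c := 1) (fun n y => by rw [(hW n).norm_map, one_mul])
      (h_lim t x) (h_lim s _)
  · refine tendsto_nhds_unique (h_lim t x).norm ?_
    simp only [(hW _).norm_map, tendsto_const_nhds]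
  · exact ((h x).continuous (Frequently.of_forall fun n => (hW n).continuous x)).continuousAt

theorem hasDerivAt_of_tendstoLocallyUniformly (hW : ∀ n, IsUnitaryGroup (W n))
    (h : ∀ x, TendstoLocallyUniformly (fun n t => W n t x) (fun t => U t x) atTop)
    {x y : E} {y' : ℕ → E} (hx : ∀ n, HasDerivAt (fun t => W n t x) (y' n) 0)
    (hy : Tendsto y' atTop (𝓝 y)) : HasDerivAt (fun t => U t x) y 0 := by
  have hU := isUnitaryGroup_of_tendstoLocallyUniformly hW h
  have h_unif : TendstoLocallyUniformly (fun n t => W n t (y' n)) (fun t => U t y) atTop := by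
    have h_diff : TendstoUniformly (fun n t => W n t (y' n - y)) (fun _ => 0) atTop := by
      refine Metric.tendstoUniformly_iff.2 fun ε hε => ?_
      filter_upwards [Metric.tendsto_nhds.1 hy ε hε] with n hn t
      rwa [dist_zero_left, (hW n).norm_map, ← dist_eq_norm]
    have h_sum := h_diff.tendstoLocallyUniformly.add (h y)
    refine (h_sum.congr fun n t => ?_).congr_right fun t => zero_add _
    simp only [Pi.add_apply, map_sub, sub_add_cancel]
  have h_deriv := hasDerivAt_of_tendstoLocallyUniformlyOn isOpen_univ
    (tendstoLocallyUniformlyOn_univ.2 h_unif)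
    (Eventually.of_forall fun n t _ => (hW n).hasDerivAt (hx n) t)
    (fun t ht => (tendstoLocallyUniformlyOn_univ.2 (h x)).tendsto_at ht) (Set.mem_univ 0)
  rwa [hU.map_zero_apply] at h_deriv

theorem norm_boundedExp_sub_boundedExp_le {B B' : E →L[ℂ] E} (hB : IsSelfAdjoint B)
    (hB' : IsSelfAdjoint B') (t : ℝ) (x : E) :
    ‖(boundedExp B t - boundedExp B' t) x‖ ≤ 2 * ‖x‖ := by
  calc ‖boundedExp B t x - boundedExp B' t x‖
    _ ≤ ‖boundedExp B t x‖ + ‖boundedExp B' t x‖ := norm_sub_le _ _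
    _ = 2 * ‖x‖ := by
      rw [(isUnitaryGroup_boundedExp hB).norm_map, (isUnitaryGroup_boundedExp hB').norm_map,
        two_mul]

variable {A : E →ₗ.[ℂ] E} {B : ℕ → E →L[ℂ] E}

theorem exists_tendsto_boundedExp (hd : Dense (A.domain : Set E)) (hB : ∀ n, IsSelfAdjoint (B n))
    (h_comm : ∀ m n, Commute (B m) (B n))
    (h_lim : ∀ x : A.domain, Tendsto (fun n => B n x) atTop (𝓝 (A x))) (t : ℝ) :
    ∃ T : E →L[ℂ] E, ∀ x, Tendsto (fun n => boundedExp (B n) t x) atTop (𝓝 (T x)) := by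
  have h_tendsto (x : E) : ∃ y, Tendsto (fun n => boundedExp (B n) t x) atTop (𝓝 y) := by
    refine cauchySeq_tendsto_of_complete (cauchySeq_iff_tendsto_dist_atTop_0.2 ?_)
    simp only [dist_eq_norm]
    refine tendsto_zero_iff_norm_tendsto_zero.1 (tendsto_zero_of_dense (l := atTop) (c := 2)
      (T := fun p : ℕ × ℕ => boundedExp (B p.1) t - boundedExp (B p.2) t)
      (fun p => norm_boundedExp_sub_boundedExp_le (hB p.1) (hB p.2) t) hd (fun x hx => ?_) x)
    refine squeeze_zero_norm (fun p => norm_boundedExp_sub_le (hB _) (hB _) (h_comm _ _) t x) ?_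
    have h_cauchy := cauchySeq_iff_tendsto_dist_atTop_0.1 (h_lim ⟨x, hx⟩).cauchySeq
    simpa only [dist_eq_norm, zero_mul] using h_cauchy.mul_const |t|
  choose f hf using h_tendsto
  exact ⟨continuousLinearMapOfTendsto (fun n => boundedExp (B n) t) (tendsto_pi_nhds.2 hf), hf⟩

theorem exists_tendstoLocallyUniformly_boundedExp (hd : Dense (A.domain : Set E))
    (hB : ∀ n, IsSelfAdjoint (B n)) (h_comm : ∀ m n, Commute (B m) (B n))
    (h_lim : ∀ x : A.domain, Tendsto (fun n => B n x) atTop (𝓝 (A x))) :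
    ∃ U : ℝ → E →L[ℂ] E, ∀ x,
      TendstoLocallyUniformly (fun n t => boundedExp (B n) t x) (fun t => U t x) atTop := by
  choose U hU using exists_tendsto_boundedExp hd hB h_comm h_lim
  refine ⟨U, fun x => ?_⟩
  rw [tendstoLocallyUniformly_iff_filter]
  intro s
  rw [tendstoUniformlyOnFilter_iff_tendsto, tendsto_uniformity_iff_dist_tendsto_zero]
  simp only [dist_eq_norm]
  refine tendsto_zero_iff_norm_tendsto_zero.1 (tendsto_zero_of_dense (c := 2)
    (T := fun p : ℕ × ℝ => U p.2 - boundedExp (B p.1) p.2) (fun p x => ?_) hd (fun x hx => ?_) x)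
  · exact le_of_tendsto ((hU p.2 x).sub_const _).norm
      (Eventually.of_forall fun n => norm_boundedExp_sub_boundedExp_le (hB n) (hB p.1) p.2 x)
  · have h_le (p : ℕ × ℝ) : ‖(U p.2 - boundedExp (B p.1) p.2) x‖ ≤
        ‖A ⟨x, hx⟩ - B p.1 x‖ * |p.2| :=
      le_of_tendsto_of_tendsto' ((hU p.2 x).sub_const _).norm
        ((((h_lim ⟨x, hx⟩).sub_const _).norm).mul_const _)
        fun n => norm_boundedExp_sub_le (hB n) (hB p.1) (h_comm n p.1) p.2 x
    refine squeeze_zero_norm h_le ?_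
    have h_left : Tendsto (fun n => ‖A ⟨x, hx⟩ - B n x‖) atTop (𝓝 0) := by
      simpa using ((h_lim ⟨x, hx⟩).const_sub (A ⟨x, hx⟩)).norm
    simpa using (h_left.comp tendsto_fst).mul ((continuous_abs.tendsto s).comp tendsto_snd)

theorem exists_isExpGroup (hA : IsSelfAdjoint A) :
    ∃ U : ℝ → E →L[ℂ] E, IsExpGroup A U := by
  have hr (n : ℕ) : (n + 1 : ℝ) ≠ 0 := n.cast_add_one_ne_zero
  have h_lim (x : A.domain) : Tendsto (fun n => yosida hA (hr n) x) atTop (𝓝 (A x)) :=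
    tendsto_yosida hA hr (tendsto_abs_atTop_atTop.comp
      (tendsto_atTop_add_const_right _ _ tendsto_natCast_atTop_atTop)) x
  have h_self (n : ℕ) := isSelfAdjoint_yosida hA (hr n)
  have hW (n : ℕ) := isUnitaryGroup_boundedExp (h_self n)
  obtain ⟨U, h_unif⟩ := exists_tendstoLocallyUniformly_boundedExp hA.dense_domain h_self
    (fun m n => commute_yosida hA (hr m) (hr n)) h_lim
  have hU := isUnitaryGroup_of_tendstoLocallyUniformly hW h_unif
  have h_deriv (x : A.domain) : HasDerivAt (fun t => U t x) (Complex.I • A x) 0 := by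
    refine hasDerivAt_of_tendstoLocallyUniformly hW h_unif
      (y' := fun n => Complex.I • yosida hA (hr n) x) (fun n => ?_) ((h_lim x).const_smul _)
    simpa only [(hW n).map_zero_apply] using
      hasDerivAt_boundedExp_apply (yosida hA (hr n)) (x : E) 0
  refine ⟨U, hU.map_zero, hU.map_add, hU.mem_unitary, hU.continuous, fun x y => ⟨fun h => ?_,
    fun h => mem_graph_of_isSelfAdjoint hA fun a => hU.inner_hasDerivAt_symm (h_deriv a) h⟩⟩
  obtain ⟨a, ha⟩ := A.mem_graph_iff'.1 h
  obtain ⟨rfl, rfl⟩ := Prod.ext_iff.1 ha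
  exact h_deriv a

namespace IsExpGroup

variable {U W : ℝ → E →L[ℂ] E}

theorem hasDerivAt (hU : IsExpGroup A U) (x : A.domain) :
    HasDerivAt (fun t => U t x) (Complex.I • A x) 0 :=
  (hU.mem_graph_iff _ _).1 (A.mem_graph x)

theorem map_mem_graph (hU : IsExpGroup A U) {x y : E} (h : (x, y) ∈ A.graph) (t : ℝ) :
    (U t x, U t y) ∈ A.graph := by
  rw [hU.mem_graph_iff, ← map_smul]
  exact hU.isUnitaryGroup.hasDerivAt_map ((hU.mem_graph_iff x y).1 h) t

theorem unique (hd : Dense (A.domain : Set E)) (hU : IsExpGroup A U) (hW : IsExpGroup A W) :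
    U = W := by
  have h_domain (t : ℝ) : Set.EqOn (U (-t)) (W (-t)) A.domain := by
    intro x hx
    have h_deriv (s : ℝ) : HasDerivAt (fun s => U s (W (-s) x)) 0 s := by
      have h := hU.isUnitaryGroup.hasDerivAt_comp_neg hW.isUnitaryGroup (s := s)
        (hW.hasDerivAt ⟨x, hx⟩)
        ((hU.mem_graph_iff _ _).1 (hW.map_mem_graph (A.mem_graph ⟨x, hx⟩) (-s)))
      simpa using h
    have h_const := is_const_of_deriv_eq_zero (fun s => (h_deriv s).differentiableAt)
      (fun s => (h_deriv s).deriv) t 0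
    simp only [neg_zero, hU.isUnitaryGroup.map_zero_apply, hW.isUnitaryGroup.map_zero_apply]
      at h_const
    rw [← hU.isUnitaryGroup.map_neg_map t (W (-t) x), h_const]
  refine funext fun t => DFunLike.coe_injective ?_
  rw [← neg_neg t]
  exact (U _).continuous.ext_on hd (W _).continuous (h_domain (-t))

end IsExpGroup

theorem existsUnique_isExpGroup (hA : IsSelfAdjoint A) :
    ∃! U : ℝ → E →L[ℂ] E, IsExpGroup A U := by
  obtain ⟨U, hU⟩ := exists_isExpGroup hA
  exact ⟨U, hU, fun W hW => hW.unique hA.dense_domain hU⟩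

end Stone

section InvariantDomain

variable {E : Type*} [NormedAddCommGroup E] [InnerProductSpace ℂ E] [CompleteSpace E]

theorem eq_zero_of_hasDerivAt_smul_of_norm_le {F : Type*} [NormedAddCommGroup F] [NormedSpace ℝ F]
    {f : ℝ → F} {r M : ℝ} (hr : r ≠ 0) (hf : ∀ t, HasDerivAt f (r • f t) t)
    (hM : ∀ t, ‖f t‖ ≤ M) : f 0 = 0 := by
  have h_exp (t : ℝ) : HasDerivAt (fun t => Real.exp (-(r * t)) • f t) 0 t := by
    have h := (((hasDerivAt_id t).const_mul r).fun_neg.exp).smul (hf t)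
    refine h.congr_deriv ?_
    simp only [id_eq]
    module
  have h_const (t : ℝ) : Real.exp (-(r * t)) • f t = f 0 := by
    simpa using is_const_of_deriv_eq_zero (fun s => (h_exp s).differentiableAt)
      (fun s => (h_exp s).deriv) t 0
  have h_bound (u : ℝ) : ‖f 0‖ ≤ Real.exp (-u) * M := by
    rw [← h_const (u / r), norm_smul, Real.norm_eq_abs, Real.abs_exp, mul_div_cancel₀ _ hr]
    exact mul_le_mul_of_nonneg_left (hM _) (Real.exp_pos _).le
  have h_lim : Tendsto (fun u => Real.exp (-u) * M) atTop (𝓝 0) := by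
    simpa using Real.tendsto_exp_neg_atTop_nhds_zero.mul_const M
  exact norm_le_zero_iff.1 (ge_of_tendsto' h_lim h_bound)

/-- `G` is a unitary group that leaves the dense domain of `A` invariant and whose generator
extends `iA`. -/
structure IsGeneratedOn (A : E →ₗ.[ℂ] E) (G : ℝ → E →L[ℂ] E) : Prop extends IsUnitaryGroup G where
  dense_domain : Dense (A.domain : Set E)
  map_mem : ∀ t, ∀ x ∈ A.domain, G t x ∈ A.domain
  hasDerivAt_zero : ∀ x : A.domain, HasDerivAt (fun t => G t x) (Complex.I • A x) 0

namespace IsGeneratedOn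

variable {A : E →ₗ.[ℂ] E} {G : ℝ → E →L[ℂ] E}

/-- The unitary group restricted to the invariant domain. -/
def flow (hG : IsGeneratedOn A G) (t : ℝ) : A.domain →ₗ[ℂ] A.domain :=
  (G t).toLinearMap.restrict (hG.map_mem t)

theorem coe_flow (hG : IsGeneratedOn A G) (t : ℝ) (x : A.domain) : (hG.flow t x : E) = G t x :=
  rfl

theorem apply_flow (hG : IsGeneratedOn A G) (t : ℝ) (x : A.domain) :
    A (hG.flow t x) = G t (A x) := by
  have h := (hG.hasDerivAt_zero (hG.flow t x)).unique
    (hG.toIsUnitaryGroup.hasDerivAt_map (hG.hasDerivAt_zero x) t)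
  rw [map_smul] at h
  exact smul_right_injective E Complex.I_ne_zero h

theorem isEssentiallySelfAdjoint (hG : IsGeneratedOn A G) : IsEssentiallySelfAdjoint A := by
  have h_dense {r : ℝ} (hr : r ≠ 0) : DenseRange (shift A r) := by
    refine denseRange_of_inner_eq_zero fun z hz => hG.dense_domain.eq_zero_of_inner_right ℂ ?_
    intro x hx
    lift x to A.domain using hx
    have h_deriv (t : ℝ) :
        HasDerivAt (fun t => inner ℂ (G t x) z) (r • inner ℂ (G t x) z) t := by
      have h_shift := hz (hG.flow t x)
      rw [shift_apply, hG.apply_flow, hG.coe_flow, inner_add_left, inner_smul_left] at h_shift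
      refine ((hG.toIsUnitaryGroup.hasDerivAt (hG.hasDerivAt_zero x) t).inner ℂ
        (hasDerivAt_const t z)).congr_deriv ?_
      rw [inner_zero_right, zero_add, map_smul, inner_smul_left,
        eq_neg_of_add_eq_zero_left h_shift, Complex.real_smul]
      simp only [map_mul, Complex.conj_ofReal, Complex.conj_I]
      linear_combination (-(r : ℂ) * inner ℂ (G t x) z) * Complex.I_mul_I
    have h_zero := eq_zero_of_hasDerivAt_smul_of_norm_le hr h_deriv fun t =>
      (norm_inner_le_norm _ _).trans_eq (by rw [hG.norm_map])
    rwa [hG.map_zero_apply] at h_zero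
  refine isEssentiallySelfAdjoint_of_denseRange_shift hG.dense_domain (fun x y => ?_) one_ne_zero
    (h_dense one_ne_zero) (h_dense (neg_ne_zero.2 one_ne_zero))
  exact hG.toIsUnitaryGroup.inner_hasDerivAt_symm (hG.hasDerivAt_zero x) (hG.hasDerivAt_zero y)

end IsGeneratedOn

end InvariantDomain

section IntegralInequalities

theorem integral_norm_le_of_lintegral_sq_le {α F F' : Type*} [MeasurableSpace α]
    [NormedAddCommGroup F] [NormedAddCommGroup F'] {μ : Measure α} [IsFiniteMeasure μ] {f : α → F}
    (hf : AEStronglyMeasurable f μ) {w : F'} (h : ∫⁻ a, ‖f a‖ₑ ^ 2 ∂μ ≤ ‖w‖ₑ ^ 2) :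
    ∫ a, ‖f a‖ ∂μ ≤ √(μ.real Set.univ) * ‖w‖ := by
  have h_two : eLpNorm f 2 μ ≤ ‖w‖ₑ := by
    refine (ENNReal.pow_le_pow_left_iff two_ne_zero).1 (le_trans (le_of_eq ?_) h)
    simpa using eLpNorm_nnreal_pow_eq_lintegral (f := f) (μ := μ) (p := 2) two_ne_zero
  have h_one := eLpNorm_le_eLpNorm_mul_rpow_measure_univ (p := 1) (q := 2) one_le_two hf
  rw [eLpNorm_one_eq_lintegral_enorm] at h_one
  rw [integral_norm_eq_lintegral_enorm hf]
  refine ENNReal.toReal_mono ?_ (h_one.trans (mul_le_mul_left h_two _)) |>.trans_eq ?_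
  · exact ENNReal.mul_ne_top enorm_ne_top
      (ENNReal.rpow_ne_top_of_nonneg (by norm_num) (measure_ne_top _ _))
  · rw [ENNReal.toReal_mul, toReal_enorm, ← ENNReal.toReal_rpow, Real.sqrt_eq_rpow, mul_comm]
    norm_num [Measure.real]

theorem intervalIntegral_norm_le_of_lintegral_sq_le {F F' : Type*} [NormedAddCommGroup F]
    [NormedAddCommGroup F'] {f : ℝ → F} {τ : ℝ} (hτ : 0 ≤ τ) (hf : Continuous f) {w : F'}
    (h : ∫⁻ s in Set.Icc 0 τ, ‖f s‖ₑ ^ 2 ≤ ‖w‖ₑ ^ 2) : ∫ s in 0..τ, ‖f s‖ ≤ √τ * ‖w‖ := by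
  have h_bound := integral_norm_le_of_lintegral_sq_le hf.aestronglyMeasurable h
  rwa [measureReal_restrict_apply_univ, Real.volume_real_Icc_of_le hτ, sub_zero,
    integral_Icc_eq_integral_Ioc, ← intervalIntegral.integral_of_le hτ] at h_bound

theorem mul_norm_le_integral_norm_add_deriv {F : Type*} [NormedAddCommGroup F] [NormedSpace ℝ F]
    [CompleteSpace F] {f f' : ℝ → F} {τ : ℝ} (hτ : 0 ≤ τ) (hf : ∀ s, HasDerivAt f (f' s) s)
    (hf' : Continuous f') :
    τ * ‖f 0‖ ≤ (∫ s in 0..τ, ‖f s‖) + τ * ∫ s in 0..τ, ‖f' s‖ := by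
  have hf_cont : Continuous f := continuous_iff_continuousAt.2 fun s => (hf s).continuousAt
  have h_deriv (s : ℝ) : HasDerivAt (fun s => (τ - s) • f s) ((τ - s) • f' s - f s) s := by
    refine (((hasDerivAt_id s).const_sub τ).smul (hf s)).congr_deriv ?_
    rw [id_eq, neg_one_smul, ← sub_eq_add_neg]
  have h_int := intervalIntegral.integral_eq_sub_of_hasDerivAt (fun s _ => h_deriv s)
    ((by fun_prop : Continuous fun s => (τ - s) • f' s - f s).intervalIntegrable 0 τ)
  have h_norm : ‖∫ s in 0..τ, ((τ - s) • f' s - f s)‖ = τ * ‖f 0‖ := by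
    rw [h_int, sub_self, zero_smul, zero_sub, sub_zero, norm_neg, norm_smul,
      Real.norm_of_nonneg hτ]
  rw [← h_norm, ← intervalIntegral.integral_const_mul, ← intervalIntegral.integral_add
    (hf_cont.norm.intervalIntegrable _ _) ((hf'.norm.const_mul τ).intervalIntegrable _ _)]
  refine intervalIntegral.norm_integral_le_of_norm_le hτ (Eventually.of_forall fun s hs => ?_)
    ((hf_cont.norm.add (hf'.norm.const_mul τ)).intervalIntegrable _ _)
  refine (norm_sub_le _ _).trans ?_
  rw [norm_smul, Real.norm_of_nonneg (sub_nonneg.2 hs.2), add_comm]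
  gcongr
  exact sub_le_self _ hs.1.le

end IntegralInequalities

section CompactOperators

variable {E F F' : Type*} [NormedAddCommGroup E] [NormedSpace ℂ E] [NormedAddCommGroup F]
  [NormedSpace ℂ F] [NormedAddCommGroup F'] [NormedSpace ℂ F']

theorem isCompactOperator_of_norm_le [CompleteSpace F] {K : E →L[ℂ] F} {C : E →L[ℂ] F'}
    (hC : IsCompactOperator C) {c : ℝ} (h : ∀ x, ‖K x‖ ≤ c * ‖C x‖) : IsCompactOperator K := by
  refine (isCompactOperator_iff_isCompact_closure_image_closedBall K.toLinearMap one_pos).2 ?_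
  have h_image : TotallyBounded (C '' Metric.closedBall 0 1) :=
    ((isCompactOperator_iff_isCompact_closure_image_closedBall C.toLinearMap one_pos).1
      hC).totallyBounded.subset subset_closure
  -- `K` is uniformly continuous for the uniform structure that `C` induces on `E`.
  let 𝒰 : UniformSpace E := UniformSpace.comap C inferInstance
  have h_ball : @TotallyBounded E 𝒰 (Metric.closedBall 0 1) :=
    (@totallyBounded_preimage E F' 𝒰 _ C _ ⟨rfl⟩ h_image).subset (Set.subset_preimage_image _ _)
  have h_unif : @UniformContinuous E F 𝒰 _ K := by
    refine tendsto_uniformity_iff_dist_tendsto_zero.2 (squeeze_zero (fun p => dist_nonneg)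
      (g := fun p : E × E => c * dist (C p.1) (C p.2)) (fun p => ?_) ?_)
    · simpa only [dist_eq_norm, map_sub] using h (p.1 - p.2)
    · have h_lim := (tendsto_uniformity_iff_dist_tendsto_zero.1 (tendsto_comap
        (f := fun p : E × E => (C p.1, C p.2)))).const_mul c
      rw [mul_zero] at h_lim
      exact h_lim
  exact (h_ball.image h_unif).closure.isCompact_of_isClosed isClosed_closure

end CompactOperators

theorem addSubgroup_eq_top_of_Icc_subset {H : AddSubgroup ℝ} {τ : ℝ} (hτ : 0 < τ)
    (h : Set.Icc 0 τ ⊆ H) : H = ⊤ := by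
  have h_open : IsOpen (H : Set ℝ) := H.isOpen_of_mem_nhds
    (mem_of_superset (Icc_mem_nhds (half_pos hτ) (half_lt_self hτ)) h)
  exact SetLike.coe_injective
    (IsClopen.eq_univ ⟨H.isClosed_of_isOpen h_open, h_open⟩ ⟨0, H.zero_mem⟩)

section KatoSmoothness

variable {E F : Type*} [NormedAddCommGroup E] [InnerProductSpace ℂ E] [CompleteSpace E]
  [NormedAddCommGroup F] [NormedSpace ℂ F] {A : E →ₗ.[ℂ] E} {G : ℝ → E →L[ℂ] E}
  {hG : IsGeneratedOn A G} {v : A.domain →ₗ[ℂ] E} {C : E →L[ℂ] F} {τ : ℝ}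

/-- The perturbation `v` is Kato smooth on `[0, τ]` with respect to the group generated by `A`, with
a bound expressed by the operator `C`. -/
def IsKatoSmooth (hG : IsGeneratedOn A G) (v : A.domain →ₗ[ℂ] E) (C : E →L[ℂ] F) (τ : ℝ) : Prop :=
  ∀ x : A.domain, ∫⁻ s in Set.Icc 0 τ, ‖v (hG.flow (-s) x)‖ₑ ^ 2 ≤ ‖C x‖ₑ ^ 2

namespace IsKatoSmooth

theorem mono (h : IsKatoSmooth hG v C τ) {σ : ℝ} (hσ : σ ≤ τ) : IsKatoSmooth hG v C σ := fun x =>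
  (lintegral_mono_set (Set.Icc_subset_Icc_right hσ)).trans (h x)

theorem lintegral_enorm_inner_sq_le (h : IsKatoSmooth hG v C τ)
    (hv : ∀ x y : A.domain, inner ℂ (v x) (y : E) = inner ℂ (x : E) (v y)) (y z : A.domain) :
    ∫⁻ s in Set.Icc 0 τ, ‖inner ℂ (v y) (G (-s) z)‖ₑ ^ 2 ≤ (‖(y : E)‖ₑ * ‖C z‖ₑ) ^ 2 := by
  calc ∫⁻ s in Set.Icc 0 τ, ‖inner ℂ (v y) (G (-s) z)‖ₑ ^ 2
    _ ≤ ∫⁻ s in Set.Icc 0 τ, ‖(y : E)‖ₑ ^ 2 * ‖v (hG.flow (-s) z)‖ₑ ^ 2 := by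
      refine lintegral_mono fun s => ?_
      rw [← hG.coe_flow, hv, ← mul_pow]
      gcongr
      simp only [enorm_eq_nnnorm, ← ENNReal.coe_mul, ENNReal.coe_le_coe]
      exact nnnorm_inner_le_nnnorm _ _
    _ = ‖(y : E)‖ₑ ^ 2 * ∫⁻ s in Set.Icc 0 τ, ‖v (hG.flow (-s) z)‖ₑ ^ 2 :=
      lintegral_const_mul' _ _ (by finiteness)
    _ ≤ ‖(y : E)‖ₑ ^ 2 * ‖C z‖ₑ ^ 2 := by
      gcongr
      exact h z
    _ = (‖(y : E)‖ₑ * ‖C z‖ₑ) ^ 2 := (mul_pow _ _ _).symm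

theorem integral_norm_inner_le (h : IsKatoSmooth hG v C τ) (hτ : 0 ≤ τ)
    (hv : ∀ x y : A.domain, inner ℂ (v x) (y : E) = inner ℂ (x : E) (v y)) (y : A.domain) (z : E) :
    ∫ s in 0..τ, ‖inner ℂ (v y) (G (-s) z)‖ ≤ √τ * (‖(y : E)‖ * ‖C z‖) := by
  have h_cont : Continuous fun p : E × ℝ => inner ℂ (v y) (G (-p.2) p.1) :=
    continuous_const.inner (hG.continuous_apply continuous_snd.neg continuous_fst)
  have h_closed : IsClosed {z : E | ∫ s in 0..τ, ‖inner ℂ (v y) (G (-s) z)‖ ≤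
      √τ * (‖(y : E)‖ * ‖C z‖)} :=
    isClosed_le (intervalIntegral.continuous_parametric_intervalIntegral_of_continuous'
      h_cont.norm 0 τ) (by fun_prop)
  refine closure_minimal (fun z hz => ?_) h_closed (hG.dense_domain z)
  lift z to A.domain using hz
  have h_sq := h.lintegral_enorm_inner_sq_le hv y z
  rw [← enorm_norm (y : E), ← enorm_norm (C z), ← enorm_mul] at h_sq
  have h_int := intervalIntegral_norm_le_of_lintegral_sq_le hτ
    (h_cont.comp (continuous_const.prodMk continuous_id)) h_sq
  rwa [norm_mul, norm_norm, norm_norm] at h_int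

theorem sqrt_mul_norm_le (h : IsKatoSmooth hG v C τ) (hτ : 0 < τ)
    (hv : ∀ x y : A.domain, inner ℂ (v x) (y : E) = inner ℂ (x : E) (v y)) (x : A.domain) :
    √τ * ‖v x‖ ≤ ‖C x‖ + τ * ‖C (A x)‖ := by
  have h_inner (y : A.domain) :
      τ * ‖inner ℂ (v y) (x : E)‖ ≤ √τ * (‖(y : E)‖ * (‖C x‖ + τ * ‖C (A x)‖)) := by
    have h_deriv (s : ℝ) : HasDerivAt (fun s => inner ℂ (v y) (G (-s) x))
        (inner ℂ (v y) (-G (-s) (Complex.I • A x))) s := by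
      simpa using (hasDerivAt_const s (v y)).inner ℂ (hG.hasDerivAt_neg (hG.hasDerivAt_zero x) s)
    have h_sobolev := mul_norm_le_integral_norm_add_deriv hτ.le h_deriv
      (continuous_const.inner (hG.continuous_apply continuous_neg continuous_const).neg)
    simp only [inner_neg_right, norm_neg, neg_zero, hG.map_zero_apply] at h_sobolev
    refine h_sobolev.trans ((add_le_add (h.integral_norm_inner_le hτ.le hv y x)
      (mul_le_mul_of_nonneg_left (h.integral_norm_inner_le hτ.le hv y _) hτ.le)).trans_eq ?_)
    rw [map_smul, norm_smul, Complex.norm_I]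
    ring
  have h_norm : ‖v x‖ ≤ (‖C x‖ + τ * ‖C (A x)‖) / √τ := by
    refine norm_le_of_dense_inner_le hG.dense_domain (by positivity) fun y hy => ?_
    lift y to A.domain using hy
    rw [← hv, div_mul_eq_mul_div, le_div_iff₀ (Real.sqrt_pos.2 hτ)]
    refine le_of_mul_le_mul_left ?_ (Real.sqrt_pos.2 hτ)
    calc √τ * (‖inner ℂ (v y) (x : E)‖ * √τ)
      _ = τ * ‖inner ℂ (v y) (x : E)‖ := by rw [mul_left_comm, Real.mul_self_sqrt hτ.le, mul_comm]
      _ ≤ √τ * ((‖C x‖ + τ * ‖C (A x)‖) * ‖(y : E)‖) :=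
        (h_inner y).trans_eq (by rw [mul_comm ‖(y : E)‖])
  rwa [le_div_iff₀' (Real.sqrt_pos.2 hτ)] at h_norm

theorem exists_norm_le_mul_norm_add (h : IsKatoSmooth hG v C τ) (hτ : 0 < τ)
    (hv : ∀ x y : A.domain, inner ℂ (v x) (y : E) = inner ℂ (x : E) (v y)) {a : NNReal}
    (ha : 0 < a) : ∃ b : NNReal, ∀ x : A.domain, ‖v x‖ ≤ a * ‖A x‖ + b * ‖(x : E)‖ := by
  obtain ⟨σ, hσ, hστ, h_small⟩ : ∃ σ, 0 < σ ∧ σ ≤ τ ∧ √σ * ‖C‖ ≤ a := by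
    refine ⟨min τ ((a / (‖C‖ + 1)) ^ 2), by positivity, min_le_left _ _, ?_⟩
    calc √(min τ ((a / (‖C‖ + 1)) ^ 2)) * ‖C‖
      _ ≤ a / (‖C‖ + 1) * (‖C‖ + 1) := by
        gcongr
        · exact Real.sqrt_le_iff.2 ⟨by positivity, min_le_right _ _⟩
        · exact (lt_add_one _).le
      _ = a := div_mul_cancel₀ _ (by positivity)
  refine ⟨‖C‖₊ / NNReal.sqrt σ.toNNReal, fun x => ?_⟩
  have hσ' := Real.sqrt_pos.2 hσ
  refine le_of_mul_le_mul_left ?_ hσ'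
  calc √σ * ‖v x‖ ≤ ‖C x‖ + σ * ‖C (A x)‖ := (h.mono hστ).sqrt_mul_norm_le hσ hv x
    _ ≤ ‖C‖ * ‖(x : E)‖ + √σ * √σ * (‖C‖ * ‖A x‖) := by
      rw [Real.mul_self_sqrt hσ.le]
      gcongr <;> exact C.le_opNorm _
    _ = √σ * (√σ * ‖C‖ * ‖A x‖ + ‖C‖ / √σ * ‖(x : E)‖) := by field_simp; ring
    _ ≤ √σ * (a * ‖A x‖ + ‖C‖ / √σ * ‖(x : E)‖) := by gcongr
    _ = _ := by simp [hσ.le]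

theorem isEssentiallySelfAdjoint (h : IsKatoSmooth hG v C τ) (hτ : 0 < τ)
    (hv : ∀ x y : A.domain, inner ℂ (v x) (y : E) = inner ℂ (x : E) (v y)) :
    IsEssentiallySelfAdjoint (perturb A v) :=
  have ⟨_, hb⟩ := h.exists_norm_le_mul_norm_add hτ hv (a := 1 / 2) (by norm_num)
  isEssentiallySelfAdjoint_perturb hG.isEssentiallySelfAdjoint hv
    (NNReal.half_lt_self one_ne_zero) hb

theorem continuous_flow (h : IsKatoSmooth hG v C τ) (hτ : 0 < τ)
    (hv : ∀ x y : A.domain, inner ℂ (v x) (y : E) = inner ℂ (x : E) (v y)) (x : A.domain) :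
    Continuous fun s => v (hG.flow (-s) x) := by
  obtain ⟨b, hb⟩ := h.exists_norm_le_mul_norm_add hτ hv one_pos
  have h_cont (y : E) : Continuous fun s => G (-s) y :=
    hG.continuous_apply continuous_neg continuous_const
  refine continuous_iff_continuousAt.2 fun s => tendsto_iff_norm_sub_tendsto_zero.2 ?_
  refine squeeze_zero (fun _ => norm_nonneg _) (fun r => ?_)
    (g := fun r => ‖G (-r) (A x) - G (-s) (A x)‖ + b * ‖G (-r) x - G (-s) x‖) ?_
  · rw [← map_sub]
    refine (hb _).trans_eq ?_
    rw [NNReal.coe_one, one_mul, LinearPMap.map_sub, hG.apply_flow, hG.apply_flow]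
    rfl
  · have h_lim (y : E) := tendsto_iff_norm_sub_tendsto_zero.1 ((h_cont y).tendsto s)
    simpa using (h_lim (A x)).add ((h_lim x).const_mul (b : ℝ))

variable {U : ℝ → E →L[ℂ] E}

theorem norm_map_map_neg_sub_le (h : IsKatoSmooth hG v C τ)
    (hv : ∀ x y : A.domain, inner ℂ (v x) (y : E) = inner ℂ (x : E) (v y)) (hU : IsUnitaryGroup U)
    (hUv : ∀ x : A.domain, HasDerivAt (fun t => U t x) (Complex.I • (A x + v x)) 0)
    (hτ : 0 ≤ τ) (x : E) :
    ‖U τ (G (-τ) x) - x‖ ≤ √τ * ‖C x‖ := by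
  have h_closed : IsClosed {x : E | ‖U τ (G (-τ) x) - x‖ ≤ √τ * ‖C x‖} :=
    isClosed_le (by fun_prop) (by fun_prop)
  refine closure_minimal (fun x hx => ?_) h_closed (hG.dense_domain x)
  lift x to A.domain using hx
  rcases hτ.eq_or_lt with rfl | hτ'
  · simp [hU.map_zero, hG.map_zero]
  have h_deriv (s : ℝ) : HasDerivAt (fun s => U s (G (-s) x))
      (U s (Complex.I • v (hG.flow (-s) x))) s := by
    convert hU.hasDerivAt_comp_neg hG.toIsUnitaryGroup (hG.hasDerivAt_zero x)
      (hUv (hG.flow (-s) x)) using 2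
    rw [hG.apply_flow, smul_add, map_smul, add_sub_cancel_left]
  have h_cont := h.continuous_flow hτ' hv x
  have h_ftc := intervalIntegral.integral_eq_sub_of_hasDerivAt (fun s _ => h_deriv s)
    ((hU.continuous_apply continuous_id (h_cont.const_smul Complex.I)).intervalIntegrable 0 τ)
  rw [neg_zero, hG.map_zero_apply, hU.map_zero_apply] at h_ftc
  calc ‖U τ (G (-τ) x) - x‖
    _ = ‖∫ s in 0..τ, U s (Complex.I • v (hG.flow (-s) x))‖ := by rw [h_ftc]
    _ ≤ ∫ s in 0..τ, ‖U s (Complex.I • v (hG.flow (-s) x))‖ :=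
      intervalIntegral.norm_integral_le_integral_norm hτ
    _ = ∫ s in 0..τ, ‖v (hG.flow (-s) x)‖ := by
      simp only [hU.norm_map, norm_smul, Complex.norm_I, one_mul]
    _ ≤ √τ * ‖C x‖ := intervalIntegral_norm_le_of_lintegral_sq_le hτ h_cont (h x)

end IsKatoSmooth

end KatoSmoothness

section WaveOperators

variable {E : Type*} [NormedAddCommGroup E] [InnerProductSpace ℂ E] [CompleteSpace E]
  {F : Type*} [NormedAddCommGroup F] [NormedSpace ℂ F] {U G : ℝ → E →L[ℂ] E}

/-- The group of times `t` at which `U t` and `G t` agree modulo the compact operators, in the sense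
that `U t G(-t) - 1` is compact. -/
def compactDifferenceTimes (hU : IsUnitaryGroup U) (hG : IsUnitaryGroup G) : AddSubgroup ℝ where
  carrier := {t | IsCompactOperator (U t ∘L G (-t) - 1 : E →L[ℂ] E)}
  zero_mem' := by
    simpa [hU.map_zero, hG.map_zero, ContinuousLinearMap.one_def] using
      (isCompactOperator_zero : IsCompactOperator (0 : E → E))
  add_mem' := by
    intro s t hs ht
    have h_split : U (s + t) ∘L G (-(s + t)) - 1 =
        U s ∘L (U t ∘L G (-t) - 1) ∘L G (-s) + (U s ∘L G (-s) - 1) := by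
      ext x
      simp [neg_add_rev, hU.map_add_apply, hG.map_add_apply]
    rw [Set.mem_ofPred_eq, h_split]
    exact ((ht.comp_clm (G (-s))).clm_comp (U s)).add hs
  neg_mem' := by
    intro t ht
    have h_neg : U (-t) ∘L G (- -t) - 1 = -(U (-t) ∘L (U t ∘L G (-t) - 1) ∘L G t) := by
      ext x
      simp [hU.map_neg_map, hG.map_neg_map]
    rw [Set.mem_ofPred_eq, h_neg]
    exact ((ht.comp_clm (G t)).clm_comp (U (-t))).neg

theorem isCompactOperator_comp_neg_sub_one_of_Icc (hU : IsUnitaryGroup U) (hG : IsUnitaryGroup G)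
    {τ : ℝ} (hτ : 0 < τ)
    (h : ∀ t ∈ Set.Icc 0 τ, IsCompactOperator (U t ∘L G (-t) - 1 : E →L[ℂ] E)) (t : ℝ) :
    IsCompactOperator (U t ∘L G (-t) - 1 : E →L[ℂ] E) := by
  have h_mem : t ∈ compactDifferenceTimes hU hG :=
    addSubgroup_eq_top_of_Icc_subset (H := compactDifferenceTimes hU hG) hτ h ▸
      AddSubgroup.mem_top t
  exact h_mem

theorem IsKatoSmooth.isCompactOperator_comp_neg_sub_one {A : E →ₗ.[ℂ] E} {hG : IsGeneratedOn A G}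
    {v : A.domain →ₗ[ℂ] E} {C : E →L[ℂ] F} {τ : ℝ} (h : IsKatoSmooth hG v C τ) (hτ : 0 < τ)
    (hv : ∀ x y : A.domain, inner ℂ (v x) (y : E) = inner ℂ (x : E) (v y))
    (hC : IsCompactOperator C) (hU : IsExpGroup (perturb A v).closure U) (t : ℝ) :
    IsCompactOperator (U t ∘L G (-t) - 1 : E →L[ℂ] E) := by
  have hUv (x : A.domain) : HasDerivAt (fun t => U t x) (Complex.I • (A x + v x)) 0 :=
    (hU.mem_graph_iff _ _).1 (LinearPMap.le_graph_of_le (perturb A v).le_closure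
      ((perturb A v).mem_graph x))
  refine isCompactOperator_comp_neg_sub_one_of_Icc hU.isUnitaryGroup hG.toIsUnitaryGroup hτ
    (fun s hs => ?_) t
  exact isCompactOperator_of_norm_le hC
    ((h.mono hs.2).norm_map_map_neg_sub_le hv hU.isUnitaryGroup hUv hs.1)

end WaveOperators

section FreePhase

theorem norm_freePhase (t ξ : ℝ) : ‖freePhase t ξ‖ = 1 :=
  Complex.norm_exp_I_mul_ofReal _

theorem freePhase_zero (ξ : ℝ) : freePhase 0 ξ = 1 := by
  simp [freePhase]

theorem freePhase_add (s t ξ : ℝ) : freePhase (s + t) ξ = freePhase s ξ * freePhase t ξ := by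
  rw [freePhase, freePhase, freePhase, ← Complex.exp_add, ← mul_add, ← Complex.ofReal_add, add_mul]

theorem iteratedDeriv_exp_I_mul_ofReal (n : ℕ) :
    iteratedDeriv n (fun x : ℝ => Complex.exp (Complex.I * x)) =
      fun x : ℝ => Complex.I ^ n * Complex.exp (Complex.I * x) := by
  induction n with
  | zero => simp
  | succ n ih =>
    rw [iteratedDeriv_succ, ih]
    funext x
    have h_deriv : HasDerivAt (fun x : ℝ => Complex.I * (x : ℂ)) Complex.I x := by
      simpa using (Complex.ofRealCLM.hasDerivAt (x := x)).const_mul Complex.I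
    rw [((h_deriv.cexp).const_mul (Complex.I ^ n)).deriv]
    ring

theorem hasTemperateGrowth_exp_I_mul_ofReal :
    Function.HasTemperateGrowth fun x : ℝ => Complex.exp (Complex.I * x) := by
  refine ⟨(contDiff_const.mul Complex.ofRealCLM.contDiff).cexp, fun n => ⟨0, 1, fun x => ?_⟩⟩
  rw [norm_iteratedFDeriv_eq_norm_iteratedDeriv, iteratedDeriv_exp_I_mul_ofReal, norm_mul, norm_pow,
    Complex.norm_I, Complex.norm_exp_I_mul_ofReal]
  simp

theorem hasTemperateGrowth_freePhase (t : ℝ) : (freePhase t).HasTemperateGrowth :=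
  hasTemperateGrowth_exp_I_mul_ofReal.comp
    (by fun_prop : Function.HasTemperateGrowth fun ξ : ℝ => t * (2 * Real.pi * ξ) ^ 2)

theorem norm_exp_I_mul_ofReal_sub_one_sub_le (x : ℝ) :
    ‖Complex.exp (Complex.I * x) - 1 - Complex.I * x‖ ≤ 2 * x ^ 2 := by
  have h_norm : ‖Complex.I * (x : ℂ)‖ = |x| := by simp
  rcases le_total |x| 1 with h | h
  · have h_small := Complex.norm_exp_sub_one_sub_id_le (x := Complex.I * x) (by rwa [h_norm])
    rw [h_norm, sq_abs] at h_small
    linarith [sq_nonneg x]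
  · calc ‖Complex.exp (Complex.I * x) - 1 - Complex.I * x‖
      _ ≤ ‖Complex.exp (Complex.I * x) - 1‖ + ‖Complex.I * (x : ℂ)‖ := norm_sub_le _ _
      _ ≤ |x| + |x| := add_le_add Real.norm_exp_I_mul_ofReal_sub_one_le h_norm.le
      _ ≤ 2 * x ^ 2 := by
        rw [← two_mul, ← sq_abs]
        gcongr
        exact le_self_pow₀ h two_ne_zero

end FreePhase

section PhaseMultiplication

/-- The unitary operator `e^{itp²}`, `p = 2πξ`, on `L²(ℝ)` in the momentum representation. -/
def phaseMul (t : ℝ) : L2 →L[ℂ] L2 :=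
  (ContinuousLinearMap.mul ℂ ℂ).holderL volume ∞ 2 2 (memLp_freePhase t).toLp

theorem coeFn_phaseMul (t : ℝ) (f : L2) :
    phaseMul t f =ᵐ[volume] fun ξ => freePhase t ξ * f ξ := by
  filter_upwards [(ContinuousLinearMap.mul ℂ ℂ).coeFn_holder (r := 2) (memLp_freePhase t).toLp f,
    (memLp_freePhase t).coeFn_toLp] with ξ h_mul h_phase
  rw [h_phase] at h_mul
  exact h_mul

theorem phaseMul_zero_apply (f : L2) : phaseMul 0 f = f := by
  refine Lp.ext ?_
  filter_upwards [coeFn_phaseMul 0 f] with ξ h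
  rw [h, freePhase_zero, one_mul]

theorem phaseMul_add_apply (s t : ℝ) (f : L2) : phaseMul (s + t) f = phaseMul s (phaseMul t f) := by
  refine Lp.ext ?_
  filter_upwards [coeFn_phaseMul (s + t) f, coeFn_phaseMul s (phaseMul t f),
    coeFn_phaseMul t f] with ξ h_add hs ht
  rw [h_add, hs, ht, freePhase_add, mul_assoc]

theorem norm_phaseMul_apply (t : ℝ) (f : L2) : ‖phaseMul t f‖ = ‖f‖ := by
  refine le_antisymm (Lp.norm_le_norm_of_ae_le ?_) (Lp.norm_le_norm_of_ae_le ?_) <;>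
  · filter_upwards [coeFn_phaseMul t f] with ξ h
    rw [h, norm_mul, norm_freePhase, one_mul]

theorem norm_phaseMul_sub_sub_le {f f₁ f₂ : L2}
    (h₁ : f₁ =ᵐ[volume] fun ξ => ((2 * Real.pi * ξ) ^ 2 : ℝ) * f ξ)
    (h₂ : f₂ =ᵐ[volume] fun ξ => ((2 * Real.pi * ξ) ^ 2 : ℝ) * f₁ ξ) (t : ℝ) :
    ‖phaseMul t f - f - (t * Complex.I : ℂ) • f₁‖ ≤ 2 * t ^ 2 * ‖f₂‖ := by
  refine Lp.norm_le_mul_norm_of_ae_le_mul ?_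
  filter_upwards [coeFn_phaseMul t f, h₁, h₂, Lp.coeFn_sub (phaseMul t f) f,
    Lp.coeFn_sub (phaseMul t f - f) ((t * Complex.I : ℂ) • f₁),
    Lp.coeFn_smul (t * Complex.I : ℂ) f₁] with ξ h_phase h_f₁ h_f₂ h_sub h_sub_sub h_smul
  have h_factor : (phaseMul t f - f - (t * Complex.I : ℂ) • f₁ : L2) ξ =
      (Complex.exp (Complex.I * (t * (2 * Real.pi * ξ) ^ 2 : ℝ)) - 1 -
        Complex.I * (t * (2 * Real.pi * ξ) ^ 2 : ℝ)) * f ξ := by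
    rw [h_sub_sub, Pi.sub_apply, h_sub, Pi.sub_apply, h_smul, Pi.smul_apply, h_phase, h_f₁,
      smul_eq_mul, freePhase]
    push_cast
    ring
  have h_norm : 2 * t ^ 2 * ‖f₂ ξ‖ = 2 * (t * (2 * Real.pi * ξ) ^ 2) ^ 2 * ‖f ξ‖ := by
    rw [h_f₂, h_f₁, norm_mul, norm_mul, Complex.norm_of_nonneg (sq_nonneg _)]
    ring
  rw [h_factor, norm_mul, h_norm]
  gcongr
  exact norm_exp_I_mul_ofReal_sub_one_sub_le _

theorem hasDerivAt_phaseMul {f f₁ f₂ : L2}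
    (h₁ : f₁ =ᵐ[volume] fun ξ => ((2 * Real.pi * ξ) ^ 2 : ℝ) * f ξ)
    (h₂ : f₂ =ᵐ[volume] fun ξ => ((2 * Real.pi * ξ) ^ 2 : ℝ) * f₁ ξ) :
    HasDerivAt (fun t => phaseMul t f) (Complex.I • f₁) 0 := by
  rw [hasDerivAt_iff_isLittleO]
  have h_bigO : (fun t : ℝ => phaseMul t f - phaseMul 0 f - (t - 0) • Complex.I • f₁) =O[𝓝 0]
      fun t : ℝ => t ^ 2 := by
    refine Asymptotics.IsBigO.of_bound (2 * ‖f₂‖) (Eventually.of_forall fun t => ?_)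
    rw [phaseMul_zero_apply, sub_zero, RCLike.real_smul_eq_coe_smul (K := ℂ) t, smul_smul, norm_pow,
      Real.norm_eq_abs, sq_abs, mul_right_comm]
    exact norm_phaseMul_sub_sub_le h₁ h₂ t
  simpa using h_bigO.trans_isLittleO (Asymptotics.isLittleO_pow_id one_lt_two)

end PhaseMultiplication

section FreeGroup

theorem fourier_momentum (Φ : 𝓢(ℝ, ℂ)) (ξ : ℝ) :
    𝓕 (momentum Φ) ξ = (2 * Real.pi * ξ : ℝ) * 𝓕 Φ ξ := by
  have h_momentum : momentum Φ = (-Complex.I) • LineDeriv.lineDerivOp (1 : ℝ) Φ := by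
    refine congrArg (fun Ψ : 𝓢(ℝ, ℂ) => (-Complex.I) • Ψ) (SchwartzMap.ext fun x => ?_)
    exact (fderiv_apply_one_eq_deriv (f := Φ)).symm
  have h_growth : Function.HasTemperateGrowth fun x : ℝ => inner ℝ x (1 : ℝ) := by fun_prop
  rw [h_momentum, FourierTransform.fourier_smul, fourier_lineDerivOp_eq, smul_apply,
    smul_apply, smulLeftCLM_apply_apply h_growth]
  simp only [smul_eq_mul, Complex.real_smul, RCLike.inner_apply, conj_trivial, one_mul]
  push_cast
  linear_combination (-(2 * Real.pi * ξ : ℂ) * 𝓕 Φ ξ) * Complex.I_mul_I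

theorem coeFn_toLp_fourier_momentum_momentum (Φ : 𝓢(ℝ, ℂ)) :
    (𝓕 (momentum (momentum Φ))).toLp 2 volume =ᵐ[volume]
      fun ξ => ((2 * Real.pi * ξ) ^ 2 : ℝ) * (𝓕 Φ).toLp 2 volume ξ := by
  filter_upwards [(𝓕 (momentum (momentum Φ))).coeFn_toLp 2, (𝓕 Φ).coeFn_toLp 2]
    with ξ h_momentum h
  rw [h_momentum, h, fourier_momentum, fourier_momentum, ← mul_assoc, ← Complex.ofReal_mul, sq]

theorem freeGroup_apply (t : ℝ) (f : L2) :
    freeGroup t f = (Lp.fourierTransformₗᵢ ℝ ℂ).symm (phaseMul t (Lp.fourierTransformₗᵢ ℝ ℂ f)) :=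
  rfl

theorem freeGroup_toLp (t : ℝ) (Φ : 𝓢(ℝ, ℂ)) :
    freeGroup t (Φ.toLp 2 volume) =
      (fourierMultiplierCLM ℂ (freePhase t) Φ).toLp 2 volume := by
  have h_phase : phaseMul t ((𝓕 Φ).toLp 2 volume) =
      (smulLeftCLM ℂ (freePhase t) (𝓕 Φ)).toLp 2 volume := by
    refine Lp.ext ?_
    filter_upwards [coeFn_phaseMul t ((𝓕 Φ).toLp 2 volume), (𝓕 Φ).coeFn_toLp 2,
      (smulLeftCLM ℂ (freePhase t) (𝓕 Φ)).coeFn_toLp 2] with ξ h_mul h_fourier h_smul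
    rw [h_mul, h_fourier, h_smul, smulLeftCLM_apply_apply (hasTemperateGrowth_freePhase t),
      smul_eq_mul]
  rw [freeGroup_apply, fourierMultiplierCLM_apply]
  exact (congrArg (fun f => (Lp.fourierTransformₗᵢ ℝ ℂ).symm (phaseMul t f))
    (SchwartzMap.toLp_fourier_eq Φ)).trans
      ((congrArg _ h_phase).trans (SchwartzMap.toLp_fourierInv_eq _))

theorem hasDerivAt_freeGroup_toLp (Φ : 𝓢(ℝ, ℂ)) :
    HasDerivAt (fun t => freeGroup t (Φ.toLp 2 volume))
      (Complex.I • (momentum (momentum Φ)).toLp 2 volume) 0 := by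
  have h_phase := hasDerivAt_phaseMul (coeFn_toLp_fourier_momentum_momentum Φ)
    (coeFn_toLp_fourier_momentum_momentum (momentum (momentum Φ)))
  let e := (Lp.fourierTransformₗᵢ ℝ ℂ : L2 ≃ₗᵢ[ℂ] L2)
  have h_fourier (Ψ : 𝓢(ℝ, ℂ)) : e (Ψ.toLp 2 volume) = (𝓕 Ψ).toLp 2 volume :=
    SchwartzMap.toLp_fourier_eq Ψ
  have h_symm := (e.symm.toContinuousLinearEquiv.toContinuousLinearMap.restrictScalars
    ℝ).hasFDerivAt.comp_hasDerivAt (0 : ℝ) h_phase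
  rw [← h_fourier, ← h_fourier, ← map_smul] at h_symm
  refine h_symm.congr_deriv (e.symm_apply_apply _)

theorem denseRange_toLp : DenseRange fun Φ : 𝓢(ℝ, ℂ) => Φ.toLp 2 (volume : Measure ℝ) :=
  denseRange_toLpCLM ENNReal.ofNat_ne_top

theorem isUnitaryGroup_freeGroup : IsUnitaryGroup freeGroup := by
  refine .of_norm_map (ContinuousLinearMap.ext fun f => ?_)
    (fun s t => ContinuousLinearMap.ext fun f => ?_) (fun t f => ?_) denseRange_toLp ?_
  · rw [freeGroup_apply, phaseMul_zero_apply, LinearIsometryEquiv.symm_apply_apply,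
      one_apply_eq_self]
  · rw [ContinuousLinearMap.comp_apply, freeGroup_apply, freeGroup_apply, freeGroup_apply,
      LinearIsometryEquiv.apply_symm_apply, phaseMul_add_apply]
  · rw [freeGroup_apply, LinearIsometryEquiv.norm_map, norm_phaseMul_apply,
      LinearIsometryEquiv.norm_map]
  · rintro _ ⟨Φ, rfl⟩
    exact (hasDerivAt_freeGroup_toLp Φ).continuousAt

end FreeGroup

section Hamiltonian

/-- The Schwartz space `𝒟` identified with the domain of the operators defined on it. -/
def schwartzEquiv (T : 𝓢(ℝ, ℂ) →ₗ[ℂ] L2) : 𝓢(ℝ, ℂ) ≃ₗ[ℂ] (onSchwartz T).domain :=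
  LinearEquiv.ofInjective (toLpCLM ℂ (E := ℝ) ℂ 2 volume).toLinearMap (injective_toLp 2 volume)

theorem onSchwartz_apply (T : 𝓢(ℝ, ℂ) →ₗ[ℂ] L2) (Φ : 𝓢(ℝ, ℂ)) :
    onSchwartz T (schwartzEquiv T Φ) = T Φ :=
  congrArg T ((schwartzEquiv T).symm_apply_apply Φ)

theorem isGeneratedOn_freeHamiltonian : IsGeneratedOn freeHamiltonian freeGroup where
  toIsUnitaryGroup := isUnitaryGroup_freeGroup
  dense_domain := denseRange_toLp
  map_mem := by
    rintro t _ ⟨Φ, rfl⟩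
    exact ⟨_, (freeGroup_toLp t Φ).symm⟩
  hasDerivAt_zero x := by
    obtain ⟨Φ, rfl⟩ := (schwartzEquiv _).surjective x
    exact (hasDerivAt_freeGroup_toLp Φ).congr_deriv
      (congrArg (fun f : L2 => Complex.I • f) (onSchwartz_apply
        ((toLpCLM ℂ (E := ℝ) ℂ 2 volume).toLinearMap ∘ₗ momentum ∘ₗ momentum) Φ).symm)

variable {V : ℝ → ℝ} (hV : DefinedOnSchwartz V)

/-- The potential as a linear map on the domain of the free Hamiltonian. -/
def potentialMap : freeHamiltonian.domain →ₗ[ℂ] L2 :=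
  (potential V hV).toFun

theorem potentialMap_apply {x : freeHamiltonian.domain} {Φ : 𝓢(ℝ, ℂ)}
    (hx : Φ.toLp 2 volume = (x : L2)) : potentialMap hV x = (hV Φ).toLp := by
  obtain rfl : schwartzEquiv _ Φ = x := Subtype.ext hx
  exact onSchwartz_apply _ Φ

theorem hamiltonian_eq_perturb : hamiltonian V hV = perturb freeHamiltonian (potentialMap hV) :=
  LinearPMap.ext (inf_idem _) fun _ _ _ => rfl

theorem inner_potentialMap_left (x y : freeHamiltonian.domain) :
    inner ℂ (potentialMap hV x) (y : L2) = inner ℂ (x : L2) (potentialMap hV y) := by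
  obtain ⟨_, Φ, rfl⟩ := x
  obtain ⟨_, Ψ, rfl⟩ := y
  rw [potentialMap_apply hV (Φ := Φ) rfl, potentialMap_apply hV (Φ := Ψ) rfl, L2.inner_def,
    L2.inner_def]
  refine integral_congr_ae ?_
  filter_upwards [Φ.coeFn_toLp 2, Ψ.coeFn_toLp 2, (hV Φ).coeFn_toLp,
    (hV Ψ).coeFn_toLp] with q hΦ hΨ hVΦ hVΨ
  calc inner ℂ ((hV Φ).toLp _ q) (Ψ.toLp 2 volume q)
    _ = inner ℂ (Φ q) ((V q : ℂ) * Ψ q) := by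
      rw [hVΦ, hΨ]
      simp only [RCLike.inner_apply, map_mul, Complex.conj_ofReal]
      ring
    _ = inner ℂ (Φ.toLp 2 volume q) ((hV Ψ).toLp _ q) := by rw [hΦ, hVΨ]

theorem enorm_potentialMap (x : freeHamiltonian.domain) :
    ‖potentialMap hV x‖ₑ = eLpNorm (fun q => (V q : ℂ) * (x : L2) q) 2 volume := by
  obtain ⟨Φ, hΦ⟩ := x.2
  rw [potentialMap_apply hV hΦ, Lp.enorm_toLp]
  refine eLpNorm_congr_ae ?_
  filter_upwards [Φ.coeFn_toLp 2] with q hq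
  rw [← hq, ← hΦ]
  rfl

end Hamiltonian

end SchrodingerPerturbation

end

open SchrodingerPerturbation in
theorem lemma6p1_general {F : Type*} [NormedAddCommGroup F] [NormedSpace ℂ F] (V : ℝ → ℝ)
    (hV : DefinedOnSchwartz V) {τ : ℝ} (hτ : 0 < τ)
    {C : L2 →L[ℂ] F} (hC : IsCompactOperator C)
    (hVC : ∀ Φ : 𝓢(ℝ, ℂ),
      ∫⁻ s in Set.Icc 0 τ,
          eLpNorm (fun x => (V x : ℂ) * freeGroup (-s) (Φ.toLp 2 volume) x) 2 volume ^ 2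
        ≤ ‖C (Φ.toLp 2 volume)‖ₑ ^ 2) :
    IsEssentiallySelfAdjoint (hamiltonian V hV) ∧
      (∃! U : ℝ → L2 →L[ℂ] L2, IsExpGroup (hamiltonian V hV).closure U) ∧
      ∀ U : ℝ → L2 →L[ℂ] L2, IsExpGroup (hamiltonian V hV).closure U →
        ∀ t : ℝ, IsCompactOperator (U t ∘L freeGroup (-t) - 1 : L2 →L[ℂ] L2) := by
  have h_smooth : IsKatoSmooth isGeneratedOn_freeHamiltonian (potentialMap hV) C τ := by
    rintro ⟨_, Φ, rfl⟩
    simp only [enorm_potentialMap, IsGeneratedOn.coe_flow]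
    exact hVC Φ
  rw [hamiltonian_eq_perturb]
  have h_symm := inner_potentialMap_left hV
  have h_ess := h_smooth.isEssentiallySelfAdjoint hτ h_symm
  exact ⟨h_ess, existsUnique_isExpGroup h_ess.2, fun U hU =>
    h_smooth.isCompactOperator_comp_neg_sub_one hτ h_symm hC hU⟩

theorem lemma6p1 (V : ℝ → ℝ) (hV : SchrodingerPerturbation.DefinedOnSchwartz V)
    (C : ℝ → SchrodingerPerturbation.L2 →L[ℂ] SchrodingerPerturbation.L2)
    (hC : ∀ t : ℝ, 0 ≤ t → IsCompactOperator (C t))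
    (hVC : ∀ t : ℝ, 0 ≤ t → ∀ Φ : 𝓢(ℝ, ℂ),
      ∫⁻ s in Set.Icc 0 t,
          eLpNorm (fun x => (V x : ℂ) *
            SchrodingerPerturbation.freeGroup (-s) (Φ.toLp 2 volume) x) 2 volume ^ 2
        ≤ ‖C t (Φ.toLp 2 volume)‖ₑ ^ 2) :
    SchrodingerPerturbation.IsEssentiallySelfAdjoint
        (SchrodingerPerturbation.hamiltonian V hV) ∧
      (∃! U : ℝ → SchrodingerPerturbation.L2 →L[ℂ] SchrodingerPerturbation.L2,
        SchrodingerPerturbation.IsExpGroup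
          (SchrodingerPerturbation.hamiltonian V hV).closure U) ∧
      ∀ U : ℝ → SchrodingerPerturbation.L2 →L[ℂ] SchrodingerPerturbation.L2,
        SchrodingerPerturbation.IsExpGroup
            (SchrodingerPerturbation.hamiltonian V hV).closure U →
          ∀ t : ℝ, IsCompactOperator
            (U t ∘L SchrodingerPerturbation.freeGroup (-t) - 1 :
              SchrodingerPerturbation.L2 →L[ℂ] SchrodingerPerturbation.L2) := by
  exact lemma6p1_general V hV one_pos (hC 1 zero_le_one) (hVC 1 zero_le_one)
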